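/- All rings are commutative and noetherian. Let $(R,\mathfrak m,k)$ be a local ring with $\mathfrak m$-adic completion $\widehat R$. Put $\operatorname{edim}R=\dim_k \mathfrak m/\mathfrak m^2$ and $\operatorname{codepth}R=\operatorname{edim}R-\operatorname{depth}R$, and call $R$ a hypersurface if $\operatorname{codepth}R\le 1$. Call $R$ Gorenstein if it has finite injective dimension as a module over itself. An ideal $I$ of a local ring $(S,\mathfrak n)$ is called a Burch ideal if $\mathfrak n I\ne\mathfrak n(I:_S\mathfrak n)$. The ring $R$, of depth $t$, is called Burch if there exist a maximal $\widehat R$-regular sequence $\boldsymbol x=x_1,\dots,x_t$ in $\widehat R$, a regular local ring $S$ and a Burch ideal $I$ of $S$ such that $\widehat R/(\boldsymbol x)\cong S/I$. Then $R$ is both Burch and Gorenstein if and only if $R$ is a hypersurface. -/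

import Mathlib

universe u

namespace Burch

open IsLocalRing RingTheory.Sequence

/-- An ideal `I` of a local ring `(R, 𝔪)` is a Burch ideal if `𝔪 I ≠ 𝔪 (I : 𝔪)`. -/
def IsBurchIdeal {R : Type u} [CommRing R] [IsLocalRing R] (I : Ideal R) : Prop :=
  maximalIdeal R * I ≠ maximalIdeal R * I.colon (maximalIdeal R : Set R)

/-- The depth of a local ring: the supremum of the lengths of the regular sequences on `R`
consisting of elements of the maximal ideal. -/
noncomputable def depth (R : Type u) [CommRing R] [IsLocalRing R] : ℕ∞ :=
  ⨆ (rs : List R) (_ : (∀ r ∈ rs, r ∈ maximalIdeal R) ∧ IsRegular R rs), (rs.length : ℕ∞)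

/-- The embedding dimension of a local ring `(R, 𝔪, k)`: the dimension of `𝔪 / 𝔪 ^ 2` over `k`. -/
noncomputable def edim (R : Type u) [CommRing R] [IsLocalRing R] : ℕ :=
  Module.finrank (ResidueField R) (CotangentSpace R)

/-- The subtraction in the definition of `codepth` below is never truncated. -/
theorem depth_le_edim (R : Type u) [CommRing R] [IsLocalRing R] [IsNoetherianRing R] :
    depth R ≤ (edim R : ℕ∞) := by
  refine iSup₂_le fun rs h => ?_
  have h1 := ringKrullDim_add_length_eq_ringKrullDim_of_isRegular rs h.2
  have h2 := ringKrullDim_le_spanFinrank_maximalIdeal R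
  rw [spanFinrank_maximalIdeal_eq_finrank_cotangentSpace, ← h1] at h2
  have hne : Nontrivial (R ⧸ Ideal.ofList rs) := by
    apply Ideal.Quotient.nontrivial_iff.mpr
    intro h0
    exact h.2.top_ne_smul (by simp [h0])
  have h3 : (rs.length : WithBot ℕ∞) ≤ ringKrullDim (R ⧸ Ideal.ofList rs) + rs.length :=
    le_add_of_nonneg_left ringKrullDim_nonneg_of_nontrivial
  exact_mod_cast h3.trans h2

/-- The codepth of a noetherian local ring: `codepth R = edim R - depth R`. -/
noncomputable def codepth (R : Type u) [CommRing R] [IsLocalRing R] : ℕ∞ :=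
  (edim R : ℕ∞) - depth R

/-- A noetherian local ring is a hypersurface if its codepth is at most `1`. -/
def IsHypersurface (R : Type u) [CommRing R] [IsLocalRing R] : Prop :=
  codepth R ≤ 1

/-- A noetherian local ring is Gorenstein if it has finite injective dimension as a module
over itself. -/
def IsGorenstein (R : Type u) [CommRing R] : Prop :=
  CategoryTheory.injectiveDimension (ModuleCat.of R R) ≠ ⊤

/-- A sequence is a maximal `A`-regular sequence if it is `A`-regular and cannot be prolonged
to a longer `A`-regular sequence. -/
def IsMaximalRegular {A : Type u} [CommRing A] (rs : List A) : Prop :=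
  IsRegular A rs ∧ ∀ y : A, ¬ IsRegular A (rs ++ [y])

/-- A noetherian local ring `R` of depth `t`, with `𝔪`-adic completion `R^`, is Burch if there are
a maximal `R^`-regular sequence `x = x₁, …, xₜ`, a regular local ring `S` and a Burch ideal `I`
of `S` such that `R^ / (x) ≅ S / I` as rings. -/
def IsBurchRing (R : Type u) [CommRing R] [IsLocalRing R] : Prop :=
  ∃ rs : List (AdicCompletion (maximalIdeal R) R),
    IsMaximalRegular rs ∧ (rs.length : ℕ∞) = depth R ∧
    ∃ (S : Type u) (_ : CommRing S) (_ : IsRegularLocalRing S) (I : Ideal S),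
      IsBurchIdeal I ∧
      Nonempty ((AdicCompletion (maximalIdeal R) R ⧸ Ideal.ofList rs) ≃+* (S ⧸ I))

end Burch

namespace Burch
open IsLocalRing RingTheory.Sequence CategoryTheory Abelian

/-! ### Injective dimension tested on cyclic modules and on the residue field -/

section Ext

variable {R : Type u} [CommRing R]

/-! Both directions reduce to the quotient `B` of the ring by a maximal regular sequence of length
`t = depth R`, a local ring with nonzero socle.

`R` is Gorenstein exactly when `B` is self-injective. If `R` has finite injective dimension, that
dimension is at most `t`: the residue field embeds in `B`, which has projective dimension `t`, and
vanishing of Ext can be tested on the residue field. Rees' shift `Hom(N, B) ≅ Ext ^ t (N, R)` then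
makes `B` self-injective, hence artinian. Conversely, a self-injective `B` is a retract of `Hom_R(B,
F)` with `F` injective, so it has finite injective dimension over `R`, and Nakayama lifts this to
`R`. Since completion does not change an artinian `B`, the property passes to the completion.

Burch and Gorenstein imply hypersurface: write `B = S/I` and pick `x ∈ 𝔫`, `a ∈ (I : 𝔫)` with `xa ∉
𝔫I`. If some `y ∈ 𝔫` were not a multiple of `x` in `B`, annihilator duality would give `d` with `dx
∈ I` and `dy - a ∈ I`, so that `xa = y(dx) - x(dy - a) ∈ 𝔫I`. Hence `x` generates the maximal ideal
of `B`, that of the completion needs at most `t + 1` generators, and `edim R ≤ t + 1`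
(`exists_maximalIdeal_eq_span_of_isBurchIdeal`).

For the converse, exchanging minimal generators gives `𝔪 = (rs) + (e)` with `rs` regular of length
`t`. Then `B` has principal nilpotent maximal ideal and is self-injective. A discrete valuation ring
`Λ` mapping to `B` and onto its residue field presents `B` as a quotient of the two-dimensional
regular ring `Λ[X]` localized at `(p, X)`, with `X ↦ e`; Krull's principal ideal theorem shows that
the kernel is Burch (`isBurchIdeal_ker`). In residue characteristic `p`, `Λ` comes from a Cohen ring
construction. -/

lemma subsingleton_of_smul_surjective [IsLocalRing R] {E : Type*} [AddCommGroup E] [Module R E]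
    [Module.Finite R E] {x : R} (hx : x ∈ maximalIdeal R) (h : ∀ e : E, ∃ e' : E, x • e' = e) :
    Subsingleton E := by
  have : (⊤ : Submodule R E) = ⊥ := by
    refine Submodule.eq_bot_of_le_smul_of_le_jacobson_bot (maximalIdeal R) ⊤
      Module.Finite.fg_top ?_ (maximalIdeal_le_jacobson _)
    intro e _
    obtain ⟨e', rfl⟩ := h e
    exact Submodule.smul_mem_smul hx trivial
  exact (Submodule.subsingleton_iff R).mp (subsingleton_of_bot_eq_top this.symm)

/-- The exact sequence `0 → I → R → R ⧸ I → 0`. -/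
noncomputable abbrev quotientShortComplex (I : Ideal R) : ShortComplex (ModuleCat.{u} R) :=
  ModuleCat.shortComplexOfCompEqZero I.subtype I.mkQ
    (LinearMap.exact_subtype_mkQ I).linearMap_comp_eq_zero

lemma quotientShortComplex_shortExact (I : Ideal R) : (quotientShortComplex I).ShortExact :=
  ModuleCat.shortComplex_shortExact _ (LinearMap.exact_subtype_mkQ I) I.injective_subtype
    I.mkQ_surjective

/-- Baer's criterion: the obstruction to extending `I → M` to `R` lies in `Ext ^ 1 (R ⧸ I, M)`. -/
lemma injective_of_subsingleton_ext_quotient (M : ModuleCat.{u} R)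
    (h : ∀ I : Ideal R, Subsingleton (Ext (ModuleCat.of R (R ⧸ I)) M 1)) : Injective M := by
  rw [← Module.injective_iff_injective_object R M, ← Module.Baer.iff_injective]
  intro I g
  obtain ⟨φ, hφ⟩ := Ext.contravariant_sequence_exact₁ (quotientShortComplex_shortExact I) M
    (Ext.mk₀ (ModuleCat.ofHom g)) (add_zero 1) ((h I).elim _ _)
  obtain ⟨f, rfl⟩ := (Ext.mk₀_bijective _ _).2 φ
  rw [Ext.mk₀_comp_mk₀, (Ext.mk₀_bijective _ _).1.eq_iff] at hφ
  refine ⟨f.hom, fun x hx => ?_⟩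
  have := congrArg (fun F => F.hom ⟨x, hx⟩) hφ
  simpa using this

/-- Dimension shifting along an embedding of `M` in an injective module reduces to Baer's criterion.
-/
lemma hasInjectiveDimensionLT_of_subsingleton_ext_quotient (n : ℕ) (M : ModuleCat.{u} R)
    (h : ∀ I : Ideal R, Subsingleton (Ext (ModuleCat.of R (R ⧸ I)) M (n + 1))) :
    HasInjectiveDimensionLT M (n + 1) := by
  induction n generalizing M with
  | zero =>
    exact injective_iff_hasInjectiveDimensionLT_one.mp (injective_of_subsingleton_ext_quotient M h)
  | succ n ih =>
    obtain ⟨E, _, f, _⟩ := EnoughInjectives.presentation M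
    let T := ShortComplex.mk f (Limits.cokernel.π f) (Limits.cokernel.condition f)
    have hT : T.ShortExact := { exact := ShortComplex.exact_cokernel f }
    refine (hT.hasInjectiveDimensionLT_X₃_iff n inferInstance).mp (ih _ fun I => ⟨?_⟩)
    suffices ∀ z : Ext (ModuleCat.of R (R ⧸ I)) T.X₃ (n + 1), z = 0 from
      fun a b => (this a).trans (this b).symm
    intro z
    obtain ⟨w, rfl⟩ := Ext.covariant_sequence_exact₃ (ModuleCat.of R (R ⧸ I)) hT z rfl
      ((h I).elim _ _)
    rw [Ext.eq_zero_of_injective w, Ext.zero_comp]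

/-- Since `Ext ^ (n + 1) (R ⧸ I, M / x M) = 0`, multiplication by `x` is onto on the finite module
`Ext ^ (n + 1) (R ⧸ I, M)`, which vanishes by Nakayama. -/
lemma hasInjectiveDimensionLT_of_quotSMulTop [IsLocalRing R] [IsNoetherianRing R]
    (M : ModuleCat.{u} R) [Module.Finite R M] {x : R} (hx : x ∈ maximalIdeal R)
    (reg : IsSMulRegular M x) (n : ℕ)
    (h : HasInjectiveDimensionLT (ModuleCat.of R (QuotSMulTop x M)) (n + 1)) :
    HasInjectiveDimensionLT M (n + 1) := by
  refine hasInjectiveDimensionLT_of_subsingleton_ext_quotient n M fun I => ?_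
  refine subsingleton_of_smul_surjective hx fun e => ?_
  obtain ⟨e', he⟩ := Ext.covariant_sequence_exact₂ (ModuleCat.of R (R ⧸ I))
    reg.smulShortComplex_shortExact e
    ((h.subsingleton _ (n + 1) (n + 1) le_rfl (ModuleCat.of R (R ⧸ I))).elim _ _)
  exact ⟨e', (Ext.smul_eq_comp_mk₀ (Y := M) e' x).trans he⟩

lemma hasInjectiveDimensionLT_of_isWeaklyRegular [IsLocalRing R] [IsNoetherianRing R]
    (rs : List R) (hrs : ∀ r ∈ rs, r ∈ maximalIdeal R) (M : ModuleCat.{u} R) [Module.Finite R M]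
    (reg : IsWeaklyRegular M rs) (n : ℕ)
    (h : HasInjectiveDimensionLT
      (ModuleCat.of R (M ⧸ (Ideal.ofList rs • ⊤ : Submodule R M))) (n + 1)) :
    HasInjectiveDimensionLT M (n + 1) := by
  induction rs generalizing M with
  | nil =>
    have e : (M ⧸ (Ideal.ofList ([] : List R) • ⊤ : Submodule R M)) ≃ₗ[R] M :=
      Submodule.quotEquivOfEqBot _ (by rw [Ideal.ofList_nil, Submodule.bot_smul])
    exact hasInjectiveDimensionLT_of_iso e.toModuleIso (n + 1)
  | cons x rs ih =>
    rw [isWeaklyRegular_cons_iff] at reg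
    simp only [List.mem_cons, forall_eq_or_imp] at hrs
    refine hasInjectiveDimensionLT_of_quotSMulTop M hrs.1 reg.1 n ?_
    refine ih hrs.2 (ModuleCat.of R (QuotSMulTop x M)) reg.2 ?_
    exact hasInjectiveDimensionLT_of_iso
      (Submodule.quotOfListConsSMulTopEquivQuotSMulTopInner M x rs).toModuleIso (n + 1)

/-- The exact sequence `0 → R ⧸ (I : x) → R ⧸ I → R ⧸ (I + (x)) → 0`. -/
noncomputable abbrev colonShortComplex (I : Ideal R) (x : R) : ShortComplex (ModuleCat.{u} R) :=
  ModuleCat.shortComplexOfCompEqZero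
    (Submodule.mapQ (I.colon {x}) I (LinearMap.lsmul R R x) (fun a ha => by
      simpa [Submodule.mem_colon_singleton, mul_comm] using ha))
    (Submodule.factor (le_sup_left : I ≤ I ⊔ Ideal.span {x})) (by
      ext
      simp only [LinearMap.comp_apply, Submodule.mapQ_apply, LinearMap.lsmul_apply,
        Submodule.mkQ_apply, LinearMap.zero_apply,
        Submodule.Quotient.mk_eq_zero]
      exact Ideal.mem_sup_right (Ideal.mul_mem_right _ _ (Ideal.mem_span_singleton_self x)))

lemma colonShortComplex_shortExact (I : Ideal R) (x : R) : (colonShortComplex I x).ShortExact := by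
  refine ModuleCat.shortComplex_shortExact _ ?_ ?_
    (Submodule.factor_surjective (le_sup_left : I ≤ I ⊔ Ideal.span {x}))
  · intro b
    obtain ⟨b, rfl⟩ := Submodule.Quotient.mk_surjective _ b
    constructor
    · intro h
      have h : (Submodule.Quotient.mk b : R ⧸ (I ⊔ Ideal.span {x})) = 0 := h
      rw [Submodule.Quotient.mk_eq_zero, Submodule.mem_sup] at h
      obtain ⟨i, hi, z, hz, rfl⟩ := h
      obtain ⟨a, rfl⟩ := Ideal.mem_span_singleton'.mp hz
      refine ⟨Submodule.Quotient.mk a, ?_⟩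
      change Submodule.Quotient.mk (x * a) = _
      rw [Submodule.Quotient.eq]
      simpa [mul_comm] using hi
    · rintro ⟨a, ha⟩
      obtain ⟨a, rfl⟩ := Submodule.Quotient.mk_surjective _ a
      rw [← ha]
      exact ConcreteCategory.congr_hom (colonShortComplex I x).zero (Submodule.Quotient.mk a)
  · refine LinearMap.ker_eq_bot.mp ((LinearMap.ker_eq_bot').mpr fun a ha => ?_)
    obtain ⟨a, rfl⟩ := Submodule.Quotient.mk_surjective _ a
    have ha : (Submodule.Quotient.mk (x * a) : R ⧸ I) = 0 := ha
    rw [Submodule.Quotient.mk_eq_zero] at ha ⊢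
    simpa [Submodule.mem_colon_singleton, mul_comm] using ha

lemma subsingleton_ext_X₂ {S : ShortComplex (ModuleCat.{u} R)} (hS : S.ShortExact)
    (M : ModuleCat.{u} R) (n : ℕ) (h₁ : Subsingleton (Ext S.X₁ M n))
    (h₃ : Subsingleton (Ext S.X₃ M n)) : Subsingleton (Ext S.X₂ M n) := by
  suffices ∀ z : Ext S.X₂ M n, z = 0 from ⟨fun a b => (this a).trans (this b).symm⟩
  intro z
  obtain ⟨w, rfl⟩ := Ext.contravariant_sequence_exact₂ hS M z (h₁.elim _ _)
  rw [h₃.elim w 0, Ext.comp_zero]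

lemma smul_eq_mk₀_comp {X Y : ModuleCat.{u} R} {n : ℕ} (e : Ext X Y n) (x : R) :
    x • e = (Ext.mk₀ (x • 𝟙 X)).comp e (zero_add n) := by
  rw [Ext.mk₀_smul, Ext.smul_comp, Ext.mk₀_id_comp]

/-- If `Ext ^ n (k, M) = 0` and `Ext ^ (n + 1) (-, M) = 0`, then `Ext ^ n (R ⧸ I, M) = 0`. -/
lemma subsingleton_ext_quotient_of_residueField [IsLocalRing R] [IsNoetherianRing R]
    (M : ModuleCat.{u} R) [Module.Finite R M] (n : ℕ) [HasInjectiveDimensionLT M (n + 1)]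
    (h : Subsingleton (Ext (ModuleCat.of R (R ⧸ maximalIdeal R)) M n)) (I : Ideal R) :
    Subsingleton (Ext (ModuleCat.of R (R ⧸ I)) M n) := by
  induction I using IsNoetherian.induction with
  | hgt I ih =>
  by_cases htop : I = ⊤
  · subst htop
    have : Limits.IsZero (ModuleCat.of R (R ⧸ (⊤ : Ideal R))) :=
      ModuleCat.isZero_of_iff_subsingleton.mpr inferInstance
    refine ⟨fun a b => ?_⟩
    rw [← Ext.mk₀_id_comp a, ← Ext.mk₀_id_comp b, this.eq_of_src (𝟙 _) 0]
    simp
  by_cases hmax : I = maximalIdeal R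
  · rwa [hmax]
  obtain ⟨x, hxm, hxI⟩ : ∃ x ∈ maximalIdeal R, x ∉ I := by
    by_contra! hc
    exact hmax (le_antisymm (le_maximalIdeal htop) hc)
  have hS := colonShortComplex_shortExact I x
  have h₃ : Subsingleton (Ext (colonShortComplex I x).X₃ M n) := by
    refine ih _ (lt_of_le_of_ne le_sup_left fun he => hxI ?_)
    rw [he]
    exact Ideal.mem_sup_right (Ideal.mem_span_singleton_self x)
  -- If `(I : x) = I`, then `x` is regular on `R ⧸ I` and Nakayama applies. Otherwise `R ⧸ I` is an
  -- extension of two cyclic modules defined by strictly larger ideals, covered by noetherian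
  -- induction.
  by_cases hcol : I.colon {x} = I
  · refine subsingleton_of_smul_surjective hxm fun e => ?_
    have hf : (colonShortComplex I x).X₁ = ModuleCat.of R (R ⧸ I) := by
      change ModuleCat.of R (R ⧸ I.colon {x}) = _
      rw [hcol]
    have hinj : Function.Injective (LinearMap.lsmul R (R ⧸ I) x) := by
      refine LinearMap.ker_eq_bot.mp ((LinearMap.ker_eq_bot').mpr fun a ha => ?_)
      obtain ⟨a, rfl⟩ := Submodule.Quotient.mk_surjective _ a
      have ha : (Submodule.Quotient.mk (x * a) : R ⧸ I) = 0 := ha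
      rw [Submodule.Quotient.mk_eq_zero] at ha ⊢
      rw [← hcol]
      simpa [Submodule.mem_colon_singleton, mul_comm] using ha
    have reg : IsSMulRegular (ModuleCat.of R (R ⧸ I)) x := hinj
    obtain ⟨e', he⟩ := Ext.contravariant_sequence_exact₁ reg.smulShortComplex_shortExact M e
      (add_comm 1 n) (Ext.eq_zero_of_hasInjectiveDimensionLT _ (n + 1) le_rfl)
    exact ⟨e', (smul_eq_mk₀_comp (X := ModuleCat.of R (R ⧸ I)) e' x).trans he⟩
  · refine subsingleton_ext_X₂ hS M n (ih _ (lt_of_le_of_ne ?_ (Ne.symm hcol))) h₃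
    intro a ha
    simpa [Submodule.mem_colon_singleton] using Ideal.mul_mem_right _ _ ha

end Ext

end Burch

namespace Burch
open IsLocalRing RingTheory.Sequence CategoryTheory Abelian Pointwise

/-! ### From a self-injective quotient to finite injective dimension -/

section RegularSequence

variable {R : Type u} [CommRing R]

/-- The exact sequence `0 → Hom (P / x P, F) → Hom (P, F) → Hom (P, F)`. -/
noncomputable abbrev homShortComplex (P F : Type u) [AddCommGroup P] [Module R P] [AddCommGroup F]
    [Module R F] (x : R) : ShortComplex (ModuleCat.{u} R) :=
  ModuleCat.shortComplexOfCompEqZero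
    (LinearMap.lcomp R F (x • (⊤ : Submodule R P)).mkQ)
    (LinearMap.lsmul R (P →ₗ[R] F) x) (by
      ext φ p
      change x • φ (Submodule.Quotient.mk p) = 0
      rw [← map_smul, ← Submodule.Quotient.mk_smul,
        (Submodule.Quotient.mk_eq_zero _).mpr (Submodule.smul_mem_pointwise_smul p x ⊤ trivial),
        map_zero])

/-- Exactness on the right is injectivity of `F`: a map `P → F` extends along the injection `x : P →
P`. -/
lemma homShortComplex_shortExact (P F : Type u) [AddCommGroup P] [Module R P] [AddCommGroup F]
    [Module R F] [Module.Injective R F] {x : R} (reg : IsSMulRegular P x) :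
    (homShortComplex P F x).ShortExact := by
  refine ModuleCat.shortComplex_shortExact _ ?_ ?_ ?_
  · intro φ
    constructor
    · intro h
      refine ⟨Submodule.liftQ _ φ ?_, ?_⟩
      · intro p hp
        obtain ⟨q, -, rfl⟩ := (Submodule.mem_smul_pointwise_iff_exists _ _ _).mp hp
        rw [LinearMap.mem_ker, map_smul]
        exact LinearMap.congr_fun h q
      · ext p
        rfl
    · rintro ⟨ψ, rfl⟩
      exact ConcreteCategory.congr_hom (homShortComplex P F x).zero ψ
  · intro φ ψ h
    ext p
    exact LinearMap.congr_fun h p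
  · intro φ
    obtain ⟨ψ, hψ⟩ := Module.Injective.out (LinearMap.lsmul R P x) reg φ
    refine ⟨ψ, ?_⟩
    ext p
    change x • ψ p = φ p
    rw [← map_smul]
    exact hψ p

/-- Each regular element replaces `Hom(P, F)` by the kernel of a surjective endomorphism, which
costs at most one dimension. -/
lemma hasInjectiveDimensionLT_hom_quotient (F : Type u) [AddCommGroup F]
    [Module R F] [Module.Injective R F] (rs : List R) (P : Type u) [AddCommGroup P] [Module R P]
    (reg : IsWeaklyRegular P rs) (d : ℕ)
    (h : HasInjectiveDimensionLT (ModuleCat.of R (P →ₗ[R] F)) (d + 1)) :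
    HasInjectiveDimensionLT
      (ModuleCat.of R ((P ⧸ (Ideal.ofList rs • ⊤ : Submodule R P)) →ₗ[R] F))
      (d + rs.length + 1) := by
  induction rs generalizing P d with
  | nil =>
    have e : P ≃ₗ[R] (P ⧸ (Ideal.ofList ([] : List R) • ⊤ : Submodule R P)) :=
      (Submodule.quotEquivOfEqBot _ (by rw [Ideal.ofList_nil, Submodule.bot_smul])).symm
    exact hasInjectiveDimensionLT_of_iso (e.arrowCongr (LinearEquiv.refl R F)).toModuleIso (d + 1)
  | cons x rs ih =>
    rw [isWeaklyRegular_cons_iff] at reg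
    have h1 := (homShortComplex_shortExact P F reg.1).hasInjectiveDimensionLT_X₁ (d + 1) h
      (hasInjectiveDimensionLT_of_ge _ (d + 1) (d + 2) (by omega))
    have h2 := ih (QuotSMulTop x P) reg.2 (d + 1) h1
    let e := (Submodule.quotOfListConsSMulTopEquivQuotSMulTopInner P x rs).symm
    let E : ((QuotSMulTop x P ⧸ (Ideal.ofList rs • ⊤ : Submodule R (QuotSMulTop x P))) →ₗ[R] F)
        ≃ₗ[R] ((P ⧸ (Ideal.ofList (x :: rs) • ⊤ : Submodule R P)) →ₗ[R] F) :=
      LinearEquiv.arrowCongr e (LinearEquiv.refl R F)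
    have h3 := hasInjectiveDimensionLT_of_iso E.toModuleIso (d + 1 + rs.length + 1)
    rwa [show d + 1 + rs.length + 1 = d + (x :: rs).length + 1 by simp; omega] at h3

/-- Modules killed by `I` are `R ⧸ I`-modules, so self-injectivity of `R ⧸ I` extends maps between
them. -/
lemma exists_extension_of_injective_quotient (I : Ideal R) [Module.Injective (R ⧸ I) (R ⧸ I)]
    {M N : Type u} [AddCommGroup M] [Module R M] [AddCommGroup N] [Module R N]
    (hM : Module.IsTorsionBySet R M I) (hN : Module.IsTorsionBySet R N I)
    (f : M →ₗ[R] N) (hf : Function.Injective f) (g : M →ₗ[R] R ⧸ I) :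
    ∃ h : N →ₗ[R] R ⧸ I, h ∘ₗ f = g := by
  let := hM.module
  let := hN.module
  have surj : Function.Surjective (algebraMap R (R ⧸ I)) := Ideal.Quotient.mk_surjective
  obtain ⟨h, hh⟩ := Module.Injective.out (f.extendScalarsOfSurjective surj) hf
    (g.extendScalarsOfSurjective surj)
  exact ⟨h.restrictScalars R, LinearMap.ext hh⟩

/-- If `rs` is regular on `R` and `R ⧸ (rs)` is self-injective, then the injective dimension
of `R ⧸ (rs)` over `R` is at most the length of `rs`. -/
lemma hasInjectiveDimensionLT_quotient_ofList (rs : List R) (reg : IsWeaklyRegular R rs)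
    [Module.Injective (R ⧸ Ideal.ofList rs) (R ⧸ Ideal.ofList rs)] :
    HasInjectiveDimensionLT
      (ModuleCat.of R (R ⧸ (Ideal.ofList rs • ⊤ : Submodule R R))) (rs.length + 1) := by
  set I := Ideal.ofList rs
  have e : (R ⧸ (I • ⊤ : Submodule R R)) ≃ₗ[R] R ⧸ I := Submodule.quotEquivOfEq _ _ (by simp)
  obtain ⟨F, _, j, _⟩ := EnoughInjectives.presentation (ModuleCat.of R (R ⧸ I))
  have hj : Function.Injective j.hom := (ModuleCat.mono_iff_injective j).mp inferInstance
  have : Module.Injective R F := Module.injective_module_of_injective_object R F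
  have hF : HasInjectiveDimensionLT (ModuleCat.of R (R →ₗ[R] F)) (0 + 1) := by
    have : HasInjectiveDimensionLT F (0 + 1) := injective_iff_hasInjectiveDimensionLT_one.mp ‹_›
    exact hasInjectiveDimensionLT_of_iso
      (X' := ModuleCat.of R (R →ₗ[R] F)) (LinearMap.ringLmapEquivSelf R R F).symm.toModuleIso
      (0 + 1)
  have hH := hasInjectiveDimensionLT_hom_quotient F rs R reg 0 hF
  rw [zero_add] at hH
  -- `θ a` is multiplication by `a` followed by the embedding `j` into the injective `F`. Source and
  -- target are killed by `I`, so `θ` splits by self-injectivity.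
  let θ : (R ⧸ I) →ₗ[R] ((R ⧸ (I • ⊤ : Submodule R R)) →ₗ[R] F) :=
    ((LinearMap.mul R (R ⧸ I)).compr₂ j.hom).compl₂ e.toLinearMap
  have hθ : Function.Injective θ := by
    refine LinearMap.ker_eq_bot.mp ((LinearMap.ker_eq_bot').mpr fun a ha => ?_)
    have h1 : j.hom (a * e (e.symm 1)) = 0 := LinearMap.congr_fun ha (e.symm 1)
    rw [LinearEquiv.apply_symm_apply, mul_one] at h1
    exact hj (h1.trans (map_zero _).symm)
  have tors : Module.IsTorsionBySet R (R ⧸ I) I  := by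
    intro b a
    obtain ⟨b, rfl⟩ := Ideal.Quotient.mk_surjective b
    change Ideal.Quotient.mk I (a * b) = 0
    exact Ideal.Quotient.eq_zero_iff_mem.mpr (I.mul_mem_right _ a.2)
  have tors' : Module.IsTorsionBySet R ((R ⧸ (I • ⊤ : Submodule R R)) →ₗ[R] F) I := by
    intro φ a
    ext
    change (a : R) • φ _ = 0
    rw [← map_smul]
    convert map_zero φ
    refine e.injective ?_
    rw [map_smul, map_zero]
    exact @tors _ a
  obtain ⟨r, hr⟩ := exists_extension_of_injective_quotient I tors tors' θ hθ LinearMap.id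
  have ret : Retract (ModuleCat.of R (R ⧸ I))
      (ModuleCat.of R ((R ⧸ (I • ⊤ : Submodule R R)) →ₗ[R] F)) :=
    { i := ModuleCat.ofHom θ, r := ModuleCat.ofHom r, 
      retract := ModuleCat.hom_ext hr }
  have := ret.hasInjectiveDimensionLT (rs.length + 1)
  exact hasInjectiveDimensionLT_of_iso e.symm.toModuleIso (rs.length + 1)

end RegularSequence

end Burch

namespace Burch
open IsLocalRing RingTheory.Sequence CategoryTheory Abelian Pointwise

/-! ### Rees' degree shift between Ext and Hom -/

section Rees

variable {R : Type u} [CommRing R]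

lemma smul_ext_eq_zero {N M : ModuleCat.{u} R} {x : R} (hx : x ∈ Module.annihilator R N) {n : ℕ}
    (z : Ext N M n) : x • z = 0 := by
  have : x • 𝟙 N = 0 := by
    ext a
    exact Module.mem_annihilator.mp hx a
  rw [smul_eq_mk₀_comp, this, Ext.mk₀_zero, Ext.zero_comp]

/-- The connecting homomorphism of `0 → M → M → M / x M → 0`. -/
noncomputable def connecting (N : ModuleCat.{u} R) {M : ModuleCat.{u} R} {x : R}
    (reg : IsSMulRegular M x) (n : ℕ) :
    Ext N (ModuleCat.of R (QuotSMulTop x M)) n →+ Ext N M (n + 1) :=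
  reg.smulShortComplex_shortExact.extClass.postcomp N rfl

lemma connecting_mk₀_comp {N N' M : ModuleCat.{u} R} (f : N ⟶ N') {x : R}
    (reg : IsSMulRegular M x) (n : ℕ) (w : Ext N' (ModuleCat.of R (QuotSMulTop x M)) n) :
    connecting N reg n ((Ext.mk₀ f).comp w (zero_add _)) =
      (Ext.mk₀ f).comp (connecting N' reg n w) (zero_add _) :=
  Ext.comp_assoc (Ext.mk₀ f) w reg.smulShortComplex_shortExact.extClass (zero_add n) rfl (by omega)

/-- As `x` kills `N`, it acts by zero on `Ext(N, M)`, so the long exact sequence makes the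
connecting map onto. -/
lemma exists_connecting_eq {N M : ModuleCat.{u} R} {x : R} (hx : x ∈ Module.annihilator R N)
    (reg : IsSMulRegular M x) {n : ℕ} (z : Ext N M (n + 1)) :
    ∃ w : Ext N (ModuleCat.of R (QuotSMulTop x M)) n, connecting N reg n w = z :=
  Ext.covariant_sequence_exact₁ N reg.smulShortComplex_shortExact z
    ((Ext.smul_eq_comp_mk₀ (Y := M) z x).symm.trans (smul_ext_eq_zero hx z)) rfl

lemma ext_eq_zero_of_connecting {N M : ModuleCat.{u} R} {x : R}
    (reg : IsSMulRegular M x) {n : ℕ} (h : ∀ z : Ext N M n, z = 0)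
    (w : Ext N (ModuleCat.of R (QuotSMulTop x M)) n)
    (hw : connecting N reg n w = 0) : w = 0 := by
  obtain ⟨z, rfl⟩ := Ext.covariant_sequence_exact₃ N reg.smulShortComplex_shortExact w rfl hw
  exact (congrArg ((Ext.mk₀ (M.smulShortComplex x).g).postcomp N (add_zero n)) (h z)).trans
    (map_zero _)

lemma ext_eq_zero_of_lt_length {N : ModuleCat.{u} R} (rs : List R)
    (hrs : ∀ r ∈ rs, r ∈ Module.annihilator R N) (M : ModuleCat.{u} R)
    (reg : IsWeaklyRegular M rs) (n : ℕ) (hn : n < rs.length) (z : Ext N M n) : z = 0 := by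
  induction rs generalizing M n with
  | nil => simp at hn
  | cons x rs ih =>
    rw [isWeaklyRegular_cons_iff] at reg
    simp only [List.mem_cons, forall_eq_or_imp] at hrs
    cases n with
    | zero =>
      obtain ⟨f, rfl⟩ := (Ext.mk₀_bijective _ _).2 z
      have : f = 0 := by
        ext a
        refine reg.1 ?_
        change x • f.hom a = x • (0 : M)
        rw [← map_smul, Module.mem_annihilator.mp hrs.1 a, map_zero, smul_zero]
      rw [this, Ext.mk₀_zero]
    | succ n =>
      obtain ⟨w, rfl⟩ := exists_connecting_eq hrs.1 reg.1 z
      have : w = 0 := ih hrs.2 (ModuleCat.of R (QuotSMulTop x M)) reg.2 n (by simpa using hn) w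
      rw [this, map_zero]

/-- Composing connecting maps embeds `Hom(N, M / (rs) M)` in `Ext ^ |rs| (N, M)`, because all lower
Ext groups vanish. -/
lemma hom_quotient_eq_zero {N : ModuleCat.{u} R} (rs : List R)
    (hrs : ∀ r ∈ rs, r ∈ Module.annihilator R N) (M : ModuleCat.{u} R)
    (reg : IsWeaklyRegular M rs) (h : ∀ z : Ext N M rs.length, z = 0)
    (g : N →ₗ[R] (M ⧸ (Ideal.ofList rs • ⊤ : Submodule R M))) : g = 0 := by
  induction rs generalizing M with
  | nil =>
    have e : (M ⧸ (Ideal.ofList ([] : List R) • ⊤ : Submodule R M)) ≃ₗ[R] M :=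
      Submodule.quotEquivOfEqBot _ (by rw [Ideal.ofList_nil, Submodule.bot_smul])
    have h1 := h (Ext.mk₀ (ModuleCat.ofHom (e.toLinearMap ∘ₗ g)))
    rw [← Ext.mk₀_zero, (Ext.mk₀_bijective _ _).1.eq_iff] at h1
    ext a
    exact e.injective ((ConcreteCategory.congr_hom h1 a).trans (map_zero e).symm)
  | cons x rs ih =>
    have hz := ext_eq_zero_of_lt_length (x :: rs) hrs M reg rs.length (by simp)
    rw [isWeaklyRegular_cons_iff] at reg
    simp only [List.mem_cons, forall_eq_or_imp] at hrs
    let e := Submodule.quotOfListConsSMulTopEquivQuotSMulTopInner M x rs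
    have := ih hrs.2 (ModuleCat.of R (QuotSMulTop x M)) reg.2
      (fun w => ext_eq_zero_of_connecting reg.1 hz w (h _)) (e.toLinearMap ∘ₗ g)
    ext a
    exact e.injective ((LinearMap.congr_fun this a).trans (map_zero e).symm)

/-- The shift `Hom(N, M / (rs) M) ≅ Ext ^ |rs| (N, M)` is natural in `N`, so surjectivity of
restriction along `f` descends from Ext to Hom. -/
lemma exists_hom_extension {N N' : ModuleCat.{u} R} (f : N ⟶ N') (rs : List R)
    (hrs : ∀ r ∈ rs, r ∈ Module.annihilator R N) (hrs' : ∀ r ∈ rs, r ∈ Module.annihilator R N')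
    (M : ModuleCat.{u} R) (reg : IsWeaklyRegular M rs)
    (h : ∀ z : Ext N M rs.length, ∃ z' : Ext N' M rs.length,
      (Ext.mk₀ f).comp z' (zero_add _) = z)
    (g : N →ₗ[R] (M ⧸ (Ideal.ofList rs • ⊤ : Submodule R M))) :
    ∃ g' : N' →ₗ[R] (M ⧸ (Ideal.ofList rs • ⊤ : Submodule R M)), g' ∘ₗ f.hom = g := by
  induction rs generalizing M with
  | nil =>
    have e : (M ⧸ (Ideal.ofList ([] : List R) • ⊤ : Submodule R M)) ≃ₗ[R] M :=
      Submodule.quotEquivOfEqBot _ (by rw [Ideal.ofList_nil, Submodule.bot_smul])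
    obtain ⟨z', hz'⟩ := h (Ext.mk₀ (ModuleCat.ofHom (e.toLinearMap ∘ₗ g)))
    obtain ⟨g', rfl⟩ := (Ext.mk₀_bijective _ _).2 z'
    rw [Ext.mk₀_comp_mk₀, (Ext.mk₀_bijective _ _).1.eq_iff] at hz'
    refine ⟨e.symm.toLinearMap ∘ₗ g'.hom, ?_⟩
    ext a
    refine e.injective ?_
    refine (LinearEquiv.apply_symm_apply e _).trans ?_
    exact ConcreteCategory.congr_hom hz' a
  | cons x rs ih =>
    have hz := ext_eq_zero_of_lt_length (x :: rs) hrs M reg rs.length (by simp)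
    rw [isWeaklyRegular_cons_iff] at reg
    simp only [List.mem_cons, forall_eq_or_imp] at hrs hrs'
    let e := Submodule.quotOfListConsSMulTopEquivQuotSMulTopInner M x rs
    obtain ⟨g', hg'⟩ := ih hrs.2 hrs'.2 (ModuleCat.of R (QuotSMulTop x M)) reg.2
      (fun w => by
        obtain ⟨z', hz'⟩ := h (connecting N reg.1 _ w)
        obtain ⟨w', rfl⟩ := exists_connecting_eq hrs'.1 reg.1 z'
        refine ⟨w', sub_eq_zero.mp (ext_eq_zero_of_connecting reg.1 hz _ ?_)⟩
        rw [map_sub, connecting_mk₀_comp, hz', sub_self]) (e.toLinearMap ∘ₗ g)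
    refine ⟨e.symm.toLinearMap ∘ₗ g', ?_⟩
    ext a
    refine e.injective ?_
    refine (LinearEquiv.apply_symm_apply e _).trans ?_
    exact LinearMap.congr_fun hg' a

end Rees

/-! ### Injective dimension bounded by the length of a maximal regular sequence -/

section Bass

variable {R : Type u} [CommRing R] [IsLocalRing R]

lemma mem_maximalIdeal_of_isRegular {rs : List R} (reg : IsRegular R rs) :
    ∀ r ∈ rs, r ∈ maximalIdeal R := by
  intro r hr
  have hne : Ideal.ofList rs ≠ ⊤ := fun h => reg.2 (by simp [h])
  exact le_maximalIdeal hne (Ideal.subset_span hr)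

/-- The socle element `s` of `R ⧸ J` gives an embedding of the residue field. -/
noncomputable def socleHom (J : Ideal R) (s : R) (hs : ∀ a ∈ maximalIdeal R, a * s ∈ J) :
    (R ⧸ maximalIdeal R) →ₗ[R] (R ⧸ (J • ⊤ : Submodule R R)) :=
  Submodule.liftQ _ (LinearMap.toSpanSingleton R _ (Submodule.Quotient.mk s)) (fun a ha => by
    change (Submodule.Quotient.mk (a * s) : R ⧸ (J • ⊤ : Submodule R R)) = 0
    rw [Submodule.Quotient.mk_eq_zero]
    simpa using hs a ha)

lemma socleHom_injective (J : Ideal R) (s : R) (hs : ∀ a ∈ maximalIdeal R, a * s ∈ J)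
    (hsJ : s ∉ J) : Function.Injective (socleHom J s hs) := by
  refine LinearMap.ker_eq_bot.mp ((LinearMap.ker_eq_bot').mpr fun a ha => ?_)
  obtain ⟨a, rfl⟩ := Submodule.Quotient.mk_surjective _ a
  have ha : (Submodule.Quotient.mk (a * s) : R ⧸ (J • ⊤ : Submodule R R)) = 0 := ha
  rw [Submodule.Quotient.mk_eq_zero] at ha ⊢
  by_contra hn
  have hu : IsUnit a := by simpa using hn
  exact hsJ ((Ideal.unit_mul_mem_iff_mem J hu).mp (by simpa using ha))

lemma annihilator_residueField {rs : List R} (hrs : ∀ r ∈ rs, r ∈ maximalIdeal R) :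
    ∀ r ∈ rs, r ∈ Module.annihilator R (ModuleCat.of R (R ⧸ maximalIdeal R)) := by
  intro r hr
  rw [show Module.annihilator R (ModuleCat.of R (R ⧸ maximalIdeal R)) = maximalIdeal R from
    Ideal.annihilator_quotient]
  exact hrs r hr

/-- A regular sequence `rs` such that `R ⧸ (rs)` has depth zero is of maximal length. -/
lemma length_le_of_socle {rs rs' : List R} (reg : IsRegular R rs) (reg' : IsRegular R rs')
    (s : R) (hs : ∀ a ∈ maximalIdeal R, a * s ∈ Ideal.ofList rs) (hsJ : s ∉ Ideal.ofList rs) :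
    rs'.length ≤ rs.length := by
  by_contra! hlt
  -- A longer `rs'` would force `Ext ^ |rs| (k, R) = 0`, hence `Hom(k, R ⧸ (rs)) = 0`, against the
  -- socle embedding.
  have h0 := hom_quotient_eq_zero rs (annihilator_residueField (mem_maximalIdeal_of_isRegular reg))
    (ModuleCat.of R R) reg.1 (ext_eq_zero_of_lt_length rs'
      (annihilator_residueField (mem_maximalIdeal_of_isRegular reg')) _ reg'.1 _ hlt) (socleHom _ s hs)
  have h1 : (Submodule.Quotient.mk 1 : R ⧸ maximalIdeal R) = 0 :=
    socleHom_injective _ s hs hsJ (by rw [h0]; rfl)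
  rw [Submodule.Quotient.mk_eq_zero] at h1
  exact (Ideal.ne_top_iff_one _).mp (maximalIdeal.isMaximal R).ne_top h1

lemma depth_eq_length_of_socle {rs : List R} (reg : IsRegular R rs)
    (s : R) (hs : ∀ a ∈ maximalIdeal R, a * s ∈ Ideal.ofList rs) (hsJ : s ∉ Ideal.ofList rs) :
    depth R = rs.length := by
  refine le_antisymm (iSup₂_le fun rs' h => ?_) ?_
  · exact_mod_cast length_le_of_socle reg h.2 s hs hsJ
  · exact le_iSup₂_of_le rs ⟨mem_maximalIdeal_of_isRegular reg, reg⟩ le_rfl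

variable [IsNoetherianRing R]

/-- The socle embeds `k` in `R ⧸ (rs)`. As `Ext ^ (n + 2) (-, R) = 0`, the map `Ext ^ (n + 1) (R ⧸
(rs), R) → Ext ^ (n + 1) (k, R)` is onto, and its source vanishes because `R ⧸ (rs)` has projective
dimension at most `n`. -/
lemma hasInjectiveDimensionLT_of_succ {rs : List R} (reg : IsRegular R rs)
    (s : R) (hs : ∀ a ∈ maximalIdeal R, a * s ∈ Ideal.ofList rs) (hsJ : s ∉ Ideal.ofList rs)
    (n : ℕ) (hn : rs.length ≤ n) (h : HasInjectiveDimensionLT (ModuleCat.of R R) (n + 2)) :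
    HasInjectiveDimensionLT (ModuleCat.of R R) (n + 1) := by
  refine hasInjectiveDimensionLT_of_subsingleton_ext_quotient n _
    (subsingleton_ext_quotient_of_residueField (ModuleCat.of R R) (n + 1) ?_)
  suffices ∀ z : Ext (ModuleCat.of R (R ⧸ maximalIdeal R)) (ModuleCat.of R R) (n + 1), z = 0 from
    ⟨fun a b => (this a).trans (this b).symm⟩
  intro z
  let i := ModuleCat.ofHom (socleHom _ s hs)
  have : Mono i := (ModuleCat.mono_iff_injective i).mpr (socleHom_injective _ s hs hsJ)
  have hS : (ShortComplex.mk i (Limits.cokernel.π i) (Limits.cokernel.condition i)).ShortExact :=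
    { exact := ShortComplex.exact_cokernel i }
  obtain ⟨w, rfl⟩ := Ext.contravariant_sequence_exact₁ hS _ z (add_comm 1 (n + 1))
    (Ext.eq_zero_of_hasInjectiveDimensionLT _ (n + 2) le_rfl)
  have hp := ModuleCat.projectiveDimension_quotient_eq_add_length_of_isWeaklyRegular
    (ModuleCat.of R R) rs reg.1 (mem_maximalIdeal_of_isRegular reg)
  have : HasProjectiveDimensionLT
      (ModuleCat.of R (R ⧸ (Ideal.ofList rs • ⊤ : Submodule R R))) (n + 1) := by
    have : HasProjectiveDimensionLE
        (ModuleCat.of R (R ⧸ (Ideal.ofList rs • ⊤ : Submodule R R))) rs.length := by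
      rw [← projectiveDimension_le_iff]
      refine hp.le.trans ?_
      have : projectiveDimension (ModuleCat.of R R) ≤ (0 : ℕ) := by
        rw [projectiveDimension_le_iff]
        change HasProjectiveDimensionLT _ 1
        infer_instance
      simpa using add_le_add_left this (rs.length : WithBot ℕ∞)
    exact hasProjectiveDimensionLT_of_ge _ (rs.length + 1) (n + 1) (by omega)
  have hw : w = 0 := (HasProjectiveDimensionLT.subsingleton _ (n + 1) (n + 1) le_rfl _).elim _ _
  rw [hw, Ext.comp_zero]

/-- If `R` has finite injective dimension over itself and `R ⧸ (rs)` has depth zero, then the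
injective dimension of `R` is at most the length of `rs`. -/
lemma hasInjectiveDimensionLT_length {rs : List R} (reg : IsRegular R rs)
    (s : R) (hs : ∀ a ∈ maximalIdeal R, a * s ∈ Ideal.ofList rs) (hsJ : s ∉ Ideal.ofList rs)
    (n : ℕ) (h : HasInjectiveDimensionLT (ModuleCat.of R R) n) :
    HasInjectiveDimensionLT (ModuleCat.of R R) (rs.length + 1) := by
  induction n with
  | zero => exact hasInjectiveDimensionLT_of_ge _ 0 _ (Nat.zero_le _)
  | succ n ih =>
    by_cases hle : n + 1 ≤ rs.length + 1
    · exact hasInjectiveDimensionLT_of_ge _ (n + 1) _ hle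
    · obtain ⟨m, rfl⟩ : ∃ m, n = m + 1 := ⟨n - 1, by omega⟩
      exact ih (hasInjectiveDimensionLT_of_succ reg s hs hsJ m (by omega) h)

omit [IsLocalRing R] [IsNoetherianRing R] in
-- Baer's criterion over `R ⧸ (rs)`: restriction to an ideal `J` is onto on `Ext ^ |rs| (-, R)`
-- since the next Ext vanishes, and Rees' shift turns this into extension of homomorphisms.
lemma injective_quotient_of_hasInjectiveDimensionLT {rs : List R} (reg : IsRegular R rs)
    (h : HasInjectiveDimensionLT (ModuleCat.of R R) (rs.length + 1)) :
    Module.Injective (R ⧸ Ideal.ofList rs) (R ⧸ Ideal.ofList rs) := by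
  rw [← Module.Baer.iff_injective]
  set I := Ideal.ofList rs with hI
  intro J g
  have e : (R ⧸ (I • ⊤ : Submodule R R)) ≃ₗ[R] R ⧸ I := Submodule.quotEquivOfEq _ _ (by simp)
  let N := ModuleCat.of R J
  let N' := ModuleCat.of R (R ⧸ I)
  let f : N ⟶ N' := ModuleCat.ofHom (J.subtype.restrictScalars R)
  have hann' : ∀ r ∈ rs, r ∈ Module.annihilator R (R ⧸ I) := fun r hr => by
    rw [Ideal.annihilator_quotient]
    exact Ideal.subset_span hr
  have hann : ∀ r ∈ rs, r ∈ Module.annihilator R J := fun r hr => by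
    rw [Module.mem_annihilator]
    intro a
    exact Subtype.ext (Module.mem_annihilator.mp (hann' r hr) a)
  have : Mono f := (ModuleCat.mono_iff_injective f).mpr J.injective_subtype
  have hS : (ShortComplex.mk f (Limits.cokernel.π f) (Limits.cokernel.condition f)).ShortExact :=
    { exact := ShortComplex.exact_cokernel f }
  obtain ⟨g', hg'⟩ := exists_hom_extension f rs hann hann' (ModuleCat.of R R) reg.1
    (fun z => Ext.contravariant_sequence_exact₁ hS _ z (add_comm 1 _)
      (Ext.eq_zero_of_hasInjectiveDimensionLT _ (rs.length + 1) le_rfl))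
    (e.symm.toLinearMap ∘ₗ g.restrictScalars R)
  have surj : Function.Surjective (algebraMap R (R ⧸ I)) := Ideal.Quotient.mk_surjective
  refine ⟨(e.toLinearMap ∘ₗ g').extendScalarsOfSurjective surj, fun x hx => ?_⟩
  change e (g' x) = _
  have := LinearMap.congr_fun hg' ⟨x, hx⟩
  rw [← LinearEquiv.apply_symm_apply e (g ⟨x, hx⟩)]
  exact congrArg e this

end Bass

end Burch

namespace Burch
open IsLocalRing RingTheory.Sequence CategoryTheory Abelian

/-! ### Self-injective local rings and Burch ideals -/

section SelfInjective

/-- Annihilator duality: `z ↦ w` is well defined on `Bz ≅ B / ann z` and extends to `B`; `c` is the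
image of `1`. -/
lemma exists_mul_eq_of_injective {B : Type u} [CommRing B] [Module.Injective B B] {z w : B}
    (h : ∀ a, a * z = 0 → a * w = 0) : ∃ c, c * z = w := by
  let K := LinearMap.ker (LinearMap.toSpanSingleton B B z)
  obtain ⟨φ, hφ⟩ := Module.Injective.out (K.liftQ (LinearMap.toSpanSingleton B B z) le_rfl)
    (LinearMap.ker_eq_bot.mp (Submodule.ker_liftQ_eq_bot _ _ _ le_rfl))
    (K.liftQ (LinearMap.toSpanSingleton B B w) h)
  refine ⟨φ 1, ?_⟩
  have h1 : φ z = w := by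
    have h2 : φ ((1 : B) • z) = (1 : B) • w := hφ (Submodule.Quotient.mk 1)
    simpa using h2
  rw [← h1, mul_comm, ← smul_eq_mul, ← map_smul, smul_eq_mul, mul_one]

variable {B : Type u} [CommRing B] [IsLocalRing B] [Module.Injective B B]

lemma exists_mul_eq_of_socle {s z : B} (hs : ∀ a ∈ maximalIdeal B, a * s = 0) (hz : z ≠ 0) :
    ∃ c, c * z = s := by
  refine exists_mul_eq_of_injective fun a ha => hs a ?_
  by_contra hn
  have hu : IsUnit a := by simpa using hn
  exact hz (hu.mul_right_eq_zero.mp ha)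

/-- By duality `s` lies in every nonzero ideal. If no power of the maximal ideal vanished, `s` would
lie in all of them, against Krull's intersection theorem. -/
lemma isArtinianRing_of_injective_of_socle [IsNoetherianRing B] {s : B}
    (hs : ∀ a ∈ maximalIdeal B, a * s = 0) (hs0 : s ≠ 0) : IsArtinianRing B := by
  rw [isArtinianRing_iff_isNilpotent_maximalIdeal]
  by_contra hn
  refine hs0 ?_
  have : s ∈ ⨅ n, maximalIdeal B ^ n := by
    rw [Submodule.mem_iInf]
    intro n
    obtain ⟨z, hz, hz0⟩ := Submodule.exists_mem_ne_zero_of_ne_bot (fun h => hn ⟨n, h⟩)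
    obtain ⟨c, rfl⟩ := exists_mul_eq_of_socle hs hz0
    exact Ideal.mul_mem_left _ _ hz
  rwa [Ideal.iInf_pow_eq_bot_of_isLocalRing _ (maximalIdeal.isMaximal B).ne_top] at this

/-- A self-injective quotient of a local ring by a Burch ideal has principal maximal ideal. -/
theorem exists_maximalIdeal_eq_span_of_isBurchIdeal {S : Type u} [CommRing S] [IsLocalRing S]
    {I : Ideal S} (hI : IsBurchIdeal I) (φ : S →+* B) (hφ : Function.Surjective φ)
    (hker : RingHom.ker φ = I) : ∃ x, maximalIdeal B = Ideal.span {x} := by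
  have hloc : IsLocalHom φ := hφ.isLocalHom _
  have hmem : ∀ y, φ y = 0 ↔ y ∈ I := fun y => by rw [← hker, RingHom.mem_ker]
  have hle : ¬ maximalIdeal S * I.colon (maximalIdeal S : Set S) ≤ maximalIdeal S * I :=
    fun h => hI (le_antisymm (Ideal.mul_mono_right fun y hy =>
      Submodule.mem_colon.mpr fun a _ => I.mul_mem_right _ hy) h)
  rw [Ideal.mul_le] at hle
  push Not at hle
  obtain ⟨x, hx, a, ha, hxa⟩ := hle
  have hlift : ∀ y ∈ maximalIdeal B, ∃ y' ∈ maximalIdeal S, φ y' = y := by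
    intro y hy
    obtain ⟨y', rfl⟩ := hφ y
    exact ⟨y', fun hu => hy (hu.map φ), rfl⟩
  have hsoc : ∀ y ∈ maximalIdeal B, y * φ a = 0 := by
    intro y hy
    obtain ⟨y, hyS, rfl⟩ := hlift y hy
    rw [← map_mul, hmem, mul_comm]
    exact Submodule.mem_colon.mp ha y hyS
  refine ⟨φ x, le_antisymm (fun y hy => ?_) ?_⟩
  · obtain ⟨y, hyS, rfl⟩ := hlift y hy
    by_contra hn
    -- If `y` is not a multiple of `x`, some `b` kills `x` but not `y`; a multiple of `by` is then
    -- the socle element `φ a`.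
    have : ¬ ∀ b, b * φ x = 0 → b * φ y = 0 := fun h =>
      hn (Ideal.mem_span_singleton'.mpr (exists_mul_eq_of_injective h))
    push Not at this
    obtain ⟨b, hbx, hby⟩ := this
    obtain ⟨c, hc⟩ := exists_mul_eq_of_socle hsoc hby
    obtain ⟨d, hd⟩ := hφ (c * b)
    have h1 : d * x ∈ I := by rw [← hmem, map_mul, hd, mul_assoc, hbx, mul_zero]
    have h2 : d * y - a ∈ I := by
      rw [← hmem, map_sub, map_mul, hd, mul_assoc, hc, sub_self]
    have h3 : x * a = y * (d * x) - x * (d * y - a) := by ring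
    rw [h3] at hxa
    exact hxa (Ideal.sub_mem _ (Ideal.mul_mem_mul hyS h1) (Ideal.mul_mem_mul hx h2))
  · rw [Ideal.span_singleton_le_iff_mem]
    exact fun hu => hx (isUnit_of_map_unit φ x hu)

end SelfInjective

/-! ### Gorenstein rings and self-injective quotients -/

section Gorenstein

variable {R : Type u} [CommRing R] [IsLocalRing R] [IsNoetherianRing R]

lemma injective_quotient_of_isGorenstein (hG : IsGorenstein R) {rs : List R}
    (reg : IsRegular R rs) (s : R) (hs : ∀ a ∈ maximalIdeal R, a * s ∈ Ideal.ofList rs)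
    (hsJ : s ∉ Ideal.ofList rs) :
    Module.Injective (R ⧸ Ideal.ofList rs) (R ⧸ Ideal.ofList rs) := by
  obtain ⟨n, hn⟩ := (injectiveDimension_ne_top_iff _).mp hG
  exact injective_quotient_of_hasInjectiveDimensionLT reg
    (hasInjectiveDimensionLT_length reg s hs hsJ (n + 1) hn)

lemma isGorenstein_of_injective_quotient {rs : List R} (reg : IsRegular R rs)
    [Module.Injective (R ⧸ Ideal.ofList rs) (R ⧸ Ideal.ofList rs)] : IsGorenstein R :=
  (injectiveDimension_ne_top_iff _).mpr ⟨rs.length,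
    hasInjectiveDimensionLT_of_isWeaklyRegular rs (mem_maximalIdeal_of_isRegular reg)
      (ModuleCat.of R R) reg.1 rs.length (hasInjectiveDimensionLT_quotient_ofList rs reg.1)⟩

end Gorenstein

end Burch

namespace Burch
open IsLocalRing RingTheory.Sequence

/-! ### The completion: noetherian, faithfully flat, same artinian quotients -/

section Completion

variable {R : Type u} [CommRing R] [IsLocalRing R] [IsNoetherianRing R]

local notation "R^" => AdicCompletion (maximalIdeal R) R

lemma mem_maximalIdeal_pow_completion_iff (n : ℕ) (x : R^) :
    x ∈ maximalIdeal R^ ^ n ↔ AdicCompletion.eval (maximalIdeal R) R n x = 0 := by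
  rw [AdicCompletion.maximalIdeal_eq_map, ← Ideal.map_pow, ← Submodule.restrictScalars_mem R,
    ← Ideal.smul_top_eq_map,
    AdicCompletion.pow_smul_top_eq_ker_eval (maximalIdeal R).fg_of_isNoetherianRing,
    LinearMap.mem_ker]

lemma algebraMap_mem_maximalIdeal_pow_completion_iff (n : ℕ) (r : R) :
    algebraMap R R^ r ∈ maximalIdeal R^ ^ n ↔ r ∈ maximalIdeal R ^ n := by
  rw [mem_maximalIdeal_pow_completion_iff]
  change (Submodule.Quotient.mk r : R ⧸ (maximalIdeal R ^ n • ⊤ : Submodule R R)) = 0 ↔ _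
  rw [Submodule.Quotient.mk_eq_zero]
  simp

lemma exists_sub_algebraMap_mem_maximalIdeal_pow (n : ℕ) (x : R^) :
    ∃ r : R, x - algebraMap R R^ r ∈ maximalIdeal R^ ^ n := by
  obtain ⟨r, hr⟩ := Submodule.Quotient.mk_surjective _ (AdicCompletion.eval (maximalIdeal R) R n x)
  refine ⟨r, ?_⟩
  rw [mem_maximalIdeal_pow_completion_iff, map_sub, ← hr]
  exact sub_self _

/-- The elements of `𝔪 ^ n` which are initial forms of degree `n` of elements of `J`. -/
def initialFiltration (J : Ideal R^) : (maximalIdeal R).Filtration R where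
  N n :=
    { carrier := {r | r ∈ maximalIdeal R ^ n ∧
        ∃ g ∈ J, algebraMap R R^ r - g ∈ maximalIdeal R^ ^ (n + 1)}
      add_mem' := by
        rintro a b ⟨ha, g, hg, hag⟩ ⟨hb, h, hh, hbh⟩
        refine ⟨add_mem ha hb, g + h, add_mem hg hh, ?_⟩
        rw [map_add, add_sub_add_comm]
        exact add_mem hag hbh
      zero_mem' := ⟨zero_mem _, 0, zero_mem _, by simp⟩
      smul_mem' := by
        rintro c a ⟨ha, g, hg, hag⟩
        refine ⟨Ideal.mul_mem_left _ _ ha, algebraMap R R^ c * g, Ideal.mul_mem_left _ _ hg, ?_⟩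
        rw [smul_eq_mul, map_mul, ← mul_sub]
        exact Ideal.mul_mem_left _ _ hag }
  mono n := by
    rintro a ⟨ha, g, hg, hag⟩
    exact ⟨Ideal.pow_le_pow_right (Nat.le_succ n) ha, g, hg,
      Ideal.pow_le_pow_right (Nat.le_succ _) hag⟩
  smul_le n := by
    rw [Submodule.smul_le]
    rintro c hc a ⟨ha, g, hg, hag⟩
    have hc' : algebraMap R R^ c ∈ maximalIdeal R^ := by
      have := (algebraMap_mem_maximalIdeal_pow_completion_iff 1 c).mpr (by simpa using hc)
      simpa using this
    refine ⟨?_, algebraMap R R^ c * g, Ideal.mul_mem_left _ _ hg, ?_⟩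
    · rw [smul_eq_mul, pow_succ']
      exact Ideal.mul_mem_mul hc ha
    · rw [smul_eq_mul, map_mul, ← mul_sub, pow_succ']
      exact Ideal.mul_mem_mul hc' hag

/-- Artin–Rees: a filtration contained in the stable `𝔪`-adic filtration of a noetherian ring is
stable. -/
lemma exists_forall_initialFiltration_eq (J : Ideal R^) :
    ∃ n₀, ∀ k, (initialFiltration J).N (n₀ + k) =
      maximalIdeal R ^ k • (initialFiltration J).N n₀ := by
  refine Ideal.Filtration.Stable.exists_pow_smul_eq
    (((maximalIdeal R).stableFiltration_stable (⊤ : Submodule R R)).of_le fun n r hr => ?_)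
  have := hr.1
  simpa using this

/-- If `g` spans `J` modulo higher order terms in every degree, then it spans the high order
part of `J`. -/
lemma mem_span_of_forall_approx {A ι : Type*} [CommRing A] [Fintype ι] (I : Ideal A)
    [IsAdicComplete I A] (g : ι → A) (J : Ideal A) (n₀ : ℕ)
    (h : ∀ n, ∀ x ∈ J ⊓ I ^ (n₀ + n), ∃ a : ι → A, (∀ i, a i ∈ I ^ n) ∧
      x - ∑ i, a i * g i ∈ J ⊓ I ^ (n₀ + (n + 1))) :
    J ⊓ I ^ n₀ ≤ Ideal.span (Set.range g) := by
  intro x hx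
  choose! a ha hxa using h
  -- `y n` is the remainder after `n` approximations and `S i n` the accumulated coefficient of `g
  -- i`; the limits of the `S i` express `x` exactly.
  let y : ℕ → A := fun n => Nat.rec x (fun n y => y - ∑ i, a n y i * g i) n
  have hy0 : y 0 = x := rfl
  have hys : ∀ n, y (n + 1) = y n - ∑ i, a n (y n) i * g i := fun _ => rfl
  have hy : ∀ n, y n ∈ J ⊓ I ^ (n₀ + n) := by
    intro n
    induction n with
    | zero => exact hx
    | succ n ih => rw [hys]; exact hxa n _ ih
  let S : ι → ℕ → A := fun i n => ∑ k ∈ Finset.range n, a k (y k) i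
  have hS : ∀ n, x = y n + ∑ i, S i n * g i := by
    intro n
    induction n with
    | zero => simp [S, hy0]
    | succ n ih =>
      have hSs : ∀ i, S i (n + 1) = S i n + a n (y n) i := fun i => Finset.sum_range_succ _ _
      simp only [hys, hSs, add_mul, Finset.sum_add_distrib]
      linear_combination ih
  have hlim : ∀ i, ∃ c, ∀ n, S i n - c ∈ I ^ n := by
    intro i
    obtain ⟨c, hc⟩ := IsPrecomplete.prec (IsAdicComplete.toIsPrecomplete (I := I) (M := A)) (f := S i) (by
      intro m n hmn
      refine SModEq.symm ?_
      rw [SModEq.sub_mem, smul_eq_mul, Ideal.mul_top]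
      simp only [S]
      rw [Finset.sum_range_sub_sum_range hmn]
      refine sum_mem fun k hk => Ideal.pow_le_pow_right ?_ (ha k _ (hy k) i)
      simp only [Finset.mem_filter] at hk
      exact hk.2)
    refine ⟨c, fun n => ?_⟩
    have := hc n
    rwa [SModEq.sub_mem, smul_eq_mul, Ideal.mul_top] at this
  choose c hc using hlim
  have hx' : x = ∑ i, c i * g i := by
    rw [← sub_eq_zero]
    refine IsHausdorff.haus (IsAdicComplete.toIsHausdorff (I := I) (M := A)) _ fun n => ?_
    rw [SModEq.zero, smul_eq_mul, Ideal.mul_top]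
    have : x - ∑ i, c i * g i = y n + ∑ i, (S i n - c i) * g i := by
      conv_lhs => rw [hS n]
      simp only [sub_mul, Finset.sum_sub_distrib]
      ring
    rw [this]
    exact add_mem (Ideal.pow_le_pow_right (Nat.le_add_left _ _) (hy n).2)
      (sum_mem fun i _ => Ideal.mul_mem_right _ _ (hc i n))
  rw [hx']
  exact sum_mem fun i _ => Ideal.mul_mem_left _ _ (Ideal.subset_span ⟨i, rfl⟩)

/-- Modulo the `n₀`-th power, `J` is described by an ideal `L` of the noetherian ring `R`; lifts of
generators of `L`, together with `K`, generate `J`. -/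
lemma fg_of_inf_pow_le_span (J : Ideal R^) (n₀ : ℕ) (K : Ideal R^) (hK : K.FG) (hKJ : K ≤ J)
    (h : J ⊓ maximalIdeal R^ ^ n₀ ≤ K) : J.FG := by
  let L : Ideal R :=
    { carrier := {r | ∃ g ∈ J, algebraMap R R^ r - g ∈ maximalIdeal R^ ^ n₀}
      add_mem' := by
        rintro a b ⟨g, hg, hag⟩ ⟨h, hh, hbh⟩
        refine ⟨g + h, add_mem hg hh, ?_⟩
        rw [map_add, add_sub_add_comm]
        exact add_mem hag hbh
      zero_mem' := ⟨0, zero_mem _, by simp⟩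
      smul_mem' := by
        rintro c a ⟨g, hg, hag⟩
        refine ⟨algebraMap R R^ c * g, Ideal.mul_mem_left _ _ hg, ?_⟩
        rw [smul_eq_mul, map_mul, ← mul_sub]
        exact Ideal.mul_mem_left _ _ hag }
  obtain ⟨s, hs⟩ := (IsNoetherian.noetherian L : L.FG)
  have hmem : ∀ r : s, ∃ g ∈ J, algebraMap R R^ r - g ∈ maximalIdeal R^ ^ n₀ := fun r => by
    have : (r : R) ∈ L := by rw [← hs]; exact Submodule.subset_span r.2
    exact this
  choose g hgJ hg using hmem
  have hle : Ideal.span (Set.range g) ≤ J := by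
    rw [Ideal.span_le]
    rintro _ ⟨r, rfl⟩
    exact hgJ r
  suffices J = K ⊔ Ideal.span (Set.range g) by
    rw [this]
    exact Submodule.FG.sup hK (Submodule.fg_span (Set.finite_range g))
  refine le_antisymm (fun x hx => ?_) (sup_le hKJ hle)
  obtain ⟨r, hr⟩ := exists_sub_algebraMap_mem_maximalIdeal_pow n₀ x
  have hrL : r ∈ Ideal.span (s : Set R) := by
    rw [Ideal.span, hs]
    exact ⟨x, hx, by rw [← neg_mem_iff, neg_sub]; exact hr⟩
  have key : ∀ r ∈ Ideal.span (s : Set R), ∃ z ∈ Ideal.span (Set.range g),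
      algebraMap R R^ r - z ∈ maximalIdeal R^ ^ n₀ := by
    intro r hr
    induction hr using Submodule.span_induction with
    | mem r h => exact ⟨g ⟨r, h⟩, Ideal.subset_span ⟨_, rfl⟩, hg ⟨r, h⟩⟩
    | zero => exact ⟨0, zero_mem _, by simp⟩
    | add a b _ _ ha hb =>
      obtain ⟨z, hz, haz⟩ := ha
      obtain ⟨w, hw, hbw⟩ := hb
      refine ⟨z + w, add_mem hz hw, ?_⟩
      rw [map_add, add_sub_add_comm]
      exact add_mem haz hbw
    | smul c a _ ha =>
      obtain ⟨z, hz, haz⟩ := ha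
      refine ⟨algebraMap R R^ c * z, Ideal.mul_mem_left _ _ hz, ?_⟩
      rw [smul_eq_mul, map_mul, ← mul_sub]
      exact Ideal.mul_mem_left _ _ haz
  obtain ⟨z, hz, hrz⟩ := key r hrL
  have hxz : x - z ∈ J ⊓ maximalIdeal R^ ^ n₀ := by
    refine ⟨sub_mem hx (hle hz), ?_⟩
    rw [← sub_add_sub_cancel x (algebraMap R R^ r) z]
    exact add_mem hr hrz
  rw [← sub_add_cancel x z]
  exact add_mem (Ideal.mem_sup_left (h hxz)) (Ideal.mem_sup_right hz)

/-- The initial forms of `J` are generated in degree `n₀`. For `x ∈ J` of order `n₀ + n`, an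
approximation in `R` is a combination of these generators with coefficients in `𝔪 ^ n`; replacing
them by their lifts `g i ∈ J` raises the order of the remainder by one. -/
instance isNoetherianRing_completion : IsNoetherianRing R^ := by
  refine ⟨fun J => ?_⟩
  obtain ⟨n₀, hn₀⟩ := exists_forall_initialFiltration_eq J
  obtain ⟨s, hs⟩ := (IsNoetherian.noetherian ((initialFiltration J).N n₀) :
    ((initialFiltration J).N n₀).FG)
  have hmem : ∀ r : s, ∃ g ∈ J, algebraMap R R^ r - g ∈ maximalIdeal R^ ^ (n₀ + 1) := fun r => by
    have : (r : R) ∈ (initialFiltration J).N n₀ := by rw [← hs]; exact Submodule.subset_span r.2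
    exact this.2
  choose g hgJ hg using hmem
  have hle : Ideal.span (Set.range g) ≤ J := by
    rw [Ideal.span_le]
    rintro _ ⟨r, rfl⟩
    exact hgJ r
  refine fg_of_inf_pow_le_span J n₀ (Ideal.span (Set.range g))
    (Submodule.fg_span (Set.finite_range g)) hle ?_
  refine mem_span_of_forall_approx (maximalIdeal R^) g J n₀ fun n x hx => ?_
  obtain ⟨r, hr⟩ := exists_sub_algebraMap_mem_maximalIdeal_pow (n₀ + n + 1) x
  have hrN : r ∈ (initialFiltration J).N (n₀ + n) := by
    refine ⟨?_, x, hx.1, by rw [← neg_mem_iff, neg_sub]; exact hr⟩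
    rw [← algebraMap_mem_maximalIdeal_pow_completion_iff]
    rw [← sub_sub_cancel x (algebraMap R R^ r)]
    exact sub_mem hx.2 (Ideal.pow_le_pow_right (Nat.le_succ _) hr)
  rw [hn₀, ← hs] at hrN
  have hr' : ∃ a : s → R, (∀ i, a i ∈ maximalIdeal R ^ n) ∧ r = ∑ i, a i * i := by
    have h1 : r ∈ (maximalIdeal R ^ n) • Submodule.span R (Set.range (fun i : s => (i : R))) := by
      simpa using hrN
    rw [Submodule.mem_ideal_smul_span_iff_exists_sum] at h1
    obtain ⟨a, ha, hsum⟩ := h1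
    refine ⟨a, ha, ?_⟩
    rw [← hsum, Finsupp.sum_fintype _ _ (by simp)]
    simp
  obtain ⟨a, ha, rfl⟩ := hr'
  have ha' : ∀ i, algebraMap R R^ (a i) ∈ maximalIdeal R^ ^ n := fun i =>
    (algebraMap_mem_maximalIdeal_pow_completion_iff n _).mpr (ha i)
  refine ⟨fun i => algebraMap R R^ (a i), ha',
    sub_mem hx.1 (sum_mem fun i _ => Ideal.mul_mem_left _ _ (hgJ i)), ?_⟩
  have hsplit : x - ∑ i, algebraMap R R^ (a i) * g i =
      (x - algebraMap R R^ (∑ i, a i * i)) +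
        ∑ i, algebraMap R R^ (a i) * (algebraMap R R^ i - g i) := by
    simp only [map_sum, map_mul, mul_sub, Finset.sum_sub_distrib]
    ring
  rw [hsplit, ← add_assoc]
  refine add_mem hr (sum_mem fun i _ => ?_)
  have := Ideal.mul_mem_mul (ha' i) (hg i)
  rwa [← pow_add, show n + (n₀ + 1) = n₀ + n + 1 by omega] at this

instance faithfullyFlat_completion : Module.FaithfullyFlat R R^ :=
  Module.FaithfullyFlat.of_flat_of_isLocalHom

lemma isRegular_map_completion {rs : List R} (reg : IsRegular R rs) :
    IsRegular R^ (rs.map (algebraMap R R^)) := reg.of_faithfullyFlat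

/-- Passing to the completion does not change an artinian quotient. -/
noncomputable def quotientCompletionEquiv (I : Ideal R) (n : ℕ) (hI : maximalIdeal R ^ n ≤ I) :
    (R ⧸ I) ≃+* (R^ ⧸ I.map (algebraMap R R^)) := by
  refine RingEquiv.ofBijective
    (Ideal.quotientMap (I.map (algebraMap R R^)) (algebraMap R R^) Ideal.le_comap_map) ⟨?_, ?_⟩
  · exact Ideal.quotientMap_injective' (Ideal.comap_map_eq_self_of_faithfullyFlat I).le
  · intro x
    obtain ⟨x, rfl⟩ := Ideal.Quotient.mk_surjective x
    obtain ⟨r, hr⟩ := exists_sub_algebraMap_mem_maximalIdeal_pow n x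
    refine ⟨Ideal.Quotient.mk _ r, ?_⟩
    rw [Ideal.quotientMap_mk, eq_comm, Ideal.Quotient.eq]
    rw [AdicCompletion.maximalIdeal_eq_map, ← Ideal.map_pow] at hr
    exact Ideal.map_mono hI hr

end Completion

end Burch

namespace Burch
open IsLocalRing RingTheory.Sequence

/-! ### Maximal regular sequences, socles and the forward direction -/

section MaximalRegular

variable {R : Type u} [CommRing R] [IsLocalRing R]

lemma isRegular_append_singleton {rs : List R} (reg : IsRegular R rs) {z : R}
    (hz : z ∈ maximalIdeal R) (h : ∀ a, z * a ∈ Ideal.ofList rs → a ∈ Ideal.ofList rs) :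
    IsRegular R (rs ++ [z]) := by
  refine (isRegular_iff_isWeaklyRegular_of_subset_maximalIdeal ?_).mpr ?_
  · intro r hr
    rcases List.mem_append.mp hr with hr | hr
    · exact mem_maximalIdeal_of_isRegular reg r hr
    · rw [List.mem_singleton.mp hr]; exact hz
  · rw [isWeaklyRegular_append_iff]
    refine ⟨reg.1, (isWeaklyRegular_singleton_iff _ _).mpr ?_⟩
    rw [isSMulRegular_quotient_iff_mem_of_smul_mem]
    intro a ha
    simpa using h a (by simpa using ha)

omit [CommRing R] [IsLocalRing R] in
lemma exists_length_max (P : List R → Prop) (N : ℕ) (hN : ∀ rs, P rs → rs.length ≤ N)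
    {rs₀ : List R} (h : P rs₀) : ∃ rs, P rs ∧ ∀ rs', P rs' → rs'.length ≤ rs.length := by
  classical
  have hQ := Nat.findGreatest_spec (P := fun n => ∃ rs, P rs ∧ rs.length = n) (hN _ h) ⟨rs₀, h, rfl⟩
  obtain ⟨rs, hrs, hlen⟩ := hQ
  exact ⟨rs, hrs, fun rs' h' => hlen ▸ Nat.le_findGreatest (hN _ h') ⟨rs', h', rfl⟩⟩

variable [IsNoetherianRing R]

lemma length_le_edim {rs : List R} (reg : IsRegular R rs) : rs.length ≤ edim R := by
  have h : (rs.length : ℕ∞) ≤ depth R :=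
    le_iSup₂_of_le (f := fun (rs : List R) (_ : (∀ r ∈ rs, r ∈ maximalIdeal R) ∧ IsRegular R rs) =>
      (rs.length : ℕ∞)) rs ⟨mem_maximalIdeal_of_isRegular reg, reg⟩ le_rfl
  exact_mod_cast h.trans (depth_le_edim R)

/-- By prime avoidance `𝔪` lies in `𝔪 ^ 2 + I` or in an associated prime of `R ⧸ I`. In the first
case Nakayama gives `𝔪 ≤ I` and `1` is a socle element; in the second the prime is the annihilator
of one. -/
lemma exists_socle_of_forall_zero_divisor {I : Ideal R} (hI : I ≠ ⊤)
    (h : ∀ z ∈ maximalIdeal R, z ∉ maximalIdeal R ^ 2 ⊔ I → ∃ a, z * a ∈ I ∧ a ∉ I) :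
    ∃ s, s ∉ I ∧ ∀ a ∈ maximalIdeal R, a * s ∈ I := by
  have hsub : (maximalIdeal R : Set R) ⊆
      ⋃ p ∈ insert (maximalIdeal R ^ 2 ⊔ I) (associatedPrimes R (R ⧸ I)), (p : Set R) := by
    intro z hz
    rw [Set.biUnion_insert, biUnion_associatedPrimes_eq_zero_divisors]
    by_cases hz2 : z ∈ maximalIdeal R ^ 2 ⊔ I
    · exact Or.inl hz2
    · obtain ⟨a, haz, ha⟩ := h z hz hz2
      refine Or.inr ⟨Ideal.Quotient.mk I a, ?_, ?_⟩
      · rwa [Ne, Ideal.Quotient.eq_zero_iff_mem]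
      · exact Ideal.Quotient.eq_zero_iff_mem.mpr haz
  -- Prime avoidance tolerates two ideals that need not be prime; `𝔪 ^ 2 + I` takes both places.
  rw [Ideal.subset_union_prime_finite ((associatedPrimes.finite R (R ⧸ I)).insert _)
    (f := fun p => p) (maximalIdeal R ^ 2 ⊔ I) (maximalIdeal R ^ 2 ⊔ I)
    (fun p hp hp' _ => ((Set.mem_insert_iff.mp hp).resolve_left hp').isPrime)] at hsub
  obtain ⟨p, hp, hle⟩ := hsub
  rcases Set.mem_insert_iff.mp hp with rfl | hp
  · refine ⟨1, (Ideal.ne_top_iff_one I).mp hI, fun a ha => ?_⟩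
    rw [mul_one]
    refine Submodule.le_of_le_smul_of_le_jacobson_bot (N := I) (N' := maximalIdeal R)
      (maximalIdeal R).fg_of_isNoetherianRing (maximalIdeal_le_jacobson ⊥) ?_ ha
    rw [smul_eq_mul, ← pow_two, sup_comm]
    exact hle
  · have hp' := isAssociatedPrime_iff.mp (AssociatedPrimes.mem_iff.mp hp)
    obtain ⟨hprime, x, hx⟩ := hp'
    obtain ⟨s, rfl⟩ := Ideal.Quotient.mk_surjective x
    refine ⟨s, fun hs => ?_, fun a ha => ?_⟩
    · refine hprime.ne_top ?_
      rw [hx, Ideal.eq_top_iff_one, Submodule.mem_colon_singleton,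
        Ideal.Quotient.eq_zero_iff_mem.mpr hs]
      simp
    · have := hle ha
      rw [hx, Submodule.mem_colon_singleton, Submodule.mem_bot] at this
      exact Ideal.Quotient.eq_zero_iff_mem.mp this

omit [IsLocalRing R] [IsNoetherianRing R] in
lemma ofList_ne_top_of_isRegular {rs : List R} (reg : IsRegular R rs) : Ideal.ofList rs ≠ ⊤ :=
  fun h => reg.2 (by simp [h])

lemma exists_socle_of_isMaximalRegular {rs : List R} (h : IsMaximalRegular rs) :
    ∃ s, s ∉ Ideal.ofList rs ∧ ∀ a ∈ maximalIdeal R, a * s ∈ Ideal.ofList rs := by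
  refine exists_socle_of_forall_zero_divisor (ofList_ne_top_of_isRegular h.1) fun z hz _ => ?_
  by_contra! hc
  exact h.2 z (isRegular_append_singleton h.1 hz hc)

variable (R) in
lemma exists_isMaximalRegular : ∃ rs : List R, IsMaximalRegular rs := by
  obtain ⟨rs, hrs, hmax⟩ := exists_length_max (fun rs : List R => IsRegular R rs) (edim R)
    (fun _ => length_le_edim) (rs₀ := []) (.nil R R)
  refine ⟨rs, hrs, fun y hy => ?_⟩
  have := hmax _ hy
  simp at this

lemma edim_eq_spanFinrank : edim R = (maximalIdeal R).spanFinrank := by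
  rw [edim, spanFinrank_maximalIdeal_eq_finrank_cotangentSpace]

lemma edim_le_of_maximalIdeal_eq_ofList {rs : List R} (h : maximalIdeal R = Ideal.ofList rs) :
    edim R ≤ rs.length := by
  classical
  rw [edim_eq_spanFinrank, h, show Ideal.ofList rs = Ideal.span (rs.toFinset : Set R) by
    simp [Ideal.ofList]]
  refine (Submodule.spanFinrank_span_le_ncard_of_finite (Finset.finite_toSet _)).trans ?_
  rw [Set.ncard_coe_finset]
  exact rs.toFinset_card_le

omit [IsNoetherianRing R] in
lemma isLocalRing_quotient {I : Ideal R} (hI : I ≠ ⊤) : IsLocalRing (R ⧸ I) :=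
  have := Ideal.Quotient.nontrivial_iff.mpr hI
  .of_surjective' _ Ideal.Quotient.mk_surjective

/-- The completion of a Gorenstein ring is Gorenstein. -/
lemma isGorenstein_completion (hG : IsGorenstein R) :
    IsGorenstein (AdicCompletion (maximalIdeal R) R) := by
  obtain ⟨rs, hrs⟩ := exists_isMaximalRegular R
  obtain ⟨s, hsJ, hs⟩ := exists_socle_of_isMaximalRegular hrs
  have hinj := injective_quotient_of_isGorenstein hG hrs.1 s hs hsJ
  have := isLocalRing_quotient (ofList_ne_top_of_isRegular hrs.1)
  have hloc : IsLocalHom (Ideal.Quotient.mk (Ideal.ofList rs)) :=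
    (Ideal.Quotient.mk_surjective (I := Ideal.ofList rs)).isLocalHom _
  have hart : IsArtinianRing (R ⧸ Ideal.ofList rs) := by
    refine isArtinianRing_of_injective_of_socle (s := Ideal.Quotient.mk _ s) (fun a ha => ?_)
      (fun h0 => hsJ (Ideal.Quotient.eq_zero_iff_mem.mp h0))
    obtain ⟨a, rfl⟩ := Ideal.Quotient.mk_surjective a
    rw [← map_mul, Ideal.Quotient.eq_zero_iff_mem]
    exact hs a fun hu => ha (hu.map _)
  -- Nilpotency puts a power of `𝔪` inside `(rs)`, so the self-injective quotient is also a quotient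
  -- of the completion.
  obtain ⟨n, hn⟩ := (isArtinianRing_iff_isNilpotent_maximalIdeal _).mp hart
  have hle : maximalIdeal R ^ n ≤ Ideal.ofList rs := by
    rw [← Ideal.mk_ker (I := Ideal.ofList rs), ← Ideal.map_eq_bot_iff_le_ker, Ideal.map_pow,
      eq_bot_iff]
    refine (Ideal.pow_right_mono ?_ n).trans hn.le
    rw [Ideal.map_le_iff_le_comap]
    exact fun a ha hu => ha (isUnit_of_map_unit _ a hu)
  have e := quotientCompletionEquiv (Ideal.ofList rs) n hle
  rw [Ideal.map_ofList] at e
  have := Module.Injective.of_ringEquiv e (M := R ⧸ Ideal.ofList rs) e.toSemilinearEquiv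
  exact isGorenstein_of_injective_quotient (isRegular_map_completion hrs.1)

/-- Modulo the given sequence the maximal ideal is principal; lifting its generator yields `t + 1`
generators in the completion, which has the same embedding dimension as `R`. -/
theorem isHypersurface_of_isBurchRing_of_isGorenstein (hB : IsBurchRing R)
    (hG : IsGorenstein R) : IsHypersurface R := by
  obtain ⟨rs, hmax, hlen, S, _, _, I, hI, ⟨e⟩⟩ := hB
  obtain ⟨s, hsJ, hs⟩ := exists_socle_of_isMaximalRegular hmax
  have hinj := injective_quotient_of_isGorenstein (isGorenstein_completion hG) hmax.1 s hs hsJ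
  have := isLocalRing_quotient (ofList_ne_top_of_isRegular hmax.1)
  obtain ⟨x, hx⟩ := exists_maximalIdeal_eq_span_of_isBurchIdeal hI
    (e.symm.toRingHom.comp (Ideal.Quotient.mk I))
    (e.symm.surjective.comp Ideal.Quotient.mk_surjective) (by
      ext y
      rw [RingHom.mem_ker, ← Ideal.Quotient.eq_zero_iff_mem]
      exact e.symm.map_eq_zero_iff)
  obtain ⟨x, rfl⟩ := Ideal.Quotient.mk_surjective x
  have hloc : IsLocalHom (Ideal.Quotient.mk (Ideal.ofList rs)) :=
    (Ideal.Quotient.mk_surjective (I := Ideal.ofList rs)).isLocalHom _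
  have hm : maximalIdeal (AdicCompletion (maximalIdeal R) R) = Ideal.ofList (x :: rs) := by
    have h1 := IsLocalRing.maximalIdeal_comap (Ideal.Quotient.mk (Ideal.ofList rs))
    rw [← h1, hx, ← Set.image_singleton, ← Ideal.map_span,
      Ideal.comap_map_of_surjective' _ Ideal.Quotient.mk_surjective, Ideal.mk_ker,
      Ideal.ofList_cons]
  have hed : edim R ≤ rs.length + 1 := by
    rw [edim_eq_spanFinrank, ← AdicCompletion.spanFinrank_maximalIdeal_eq, ← edim_eq_spanFinrank]
    exact edim_le_of_maximalIdeal_eq_ofList hm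
  rw [IsHypersurface, codepth, ← hlen, tsub_le_iff_left]
  exact_mod_cast hed

end MaximalRegular

end Burch

namespace Burch
open IsLocalRing RingTheory.Sequence

/-! ### Local rings with principal maximal ideal -/

section PrincipalMaximalIdeal

variable {B : Type u} [CommRing B] [IsLocalRing B] {e : B}

/-- Divide by `e` until the cofactor is a unit or the exponent reaches `N`. -/
lemma exists_isUnit_mul_pow_or (he : maximalIdeal B = Ideal.span {e}) (N : ℕ) (x : B) :
    (∃ k < N, ∃ u, IsUnit u ∧ x = u * e ^ k) ∨ ∃ c, x = c * e ^ N := by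
  induction N with
  | zero => exact Or.inr ⟨x, by simp⟩
  | succ N ih =>
    rcases ih with ⟨k, hk, h⟩ | ⟨c, rfl⟩
    · exact Or.inl ⟨k, hk.trans N.lt_succ_self, h⟩
    · by_cases hc : IsUnit c
      · exact Or.inl ⟨N, N.lt_succ_self, c, hc, rfl⟩
      · have hc' : c ∈ maximalIdeal B := hc
        rw [he, Ideal.mem_span_singleton'] at hc'
        obtain ⟨d, rfl⟩ := hc'
        exact Or.inr ⟨d, by ring⟩

/-- By Krull's intersection theorem `s = u * e ^ k` with `u` a unit, and `e * s = 0` gives `e ^ (k +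
1) = 0`. -/
lemma isNilpotent_of_socle [IsNoetherianRing B] (he : maximalIdeal B = Ideal.span {e}) {s : B}
    (hs0 : s ≠ 0) (hs : ∀ a ∈ maximalIdeal B, a * s = 0) : IsNilpotent e := by
  have hKrull := Ideal.iInf_pow_eq_bot_of_isLocalRing (maximalIdeal B)
    (maximalIdeal.isMaximal B).ne_top
  have : ∃ N, s ∉ maximalIdeal B ^ N := by
    by_contra! h
    exact hs0 (by rw [← Ideal.mem_bot, ← hKrull]; exact (Submodule.mem_iInf _).mpr h)
  obtain ⟨N, hN⟩ := this
  rcases exists_isUnit_mul_pow_or he N s with ⟨k, -, u, hu, rfl⟩ | ⟨c, rfl⟩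
  · refine ⟨k + 1, ?_⟩
    have := hs e (by rw [he]; exact Ideal.mem_span_singleton_self e)
    rwa [mul_left_comm, ← pow_succ', hu.mul_right_eq_zero] at this
  · refine (hN ?_).elim
    rw [he, Ideal.span_singleton_pow]
    exact Ideal.mul_mem_left _ _ (Ideal.mem_span_singleton_self _)

/-- A local ring whose maximal ideal is principal and nilpotent is self-injective. -/
lemma injective_of_maximalIdeal_eq_span (he : maximalIdeal B = Ideal.span {e})
    (hnil : IsNilpotent e) : Module.Injective B B := by
  refine Module.Baer.injective fun I g => ?_
  classical
  set n := Nat.find hnil with hn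
  have hen : e ^ n = 0 := Nat.find_spec hnil
  have hlt : ∀ k, e ^ k = 0 → n ≤ k := fun k hk => Nat.find_min' hnil hk
  have hI : ∃ k, e ^ k ∈ I := ⟨n, by rw [hen]; exact zero_mem _⟩
  set k := Nat.find hI with hk
  have hekI : e ^ k ∈ I := Nat.find_spec hI
  have hkn : k ≤ n := Nat.find_min' hI (by rw [hen]; exact zero_mem _)
  have hgen : ∀ x ∈ I, ∃ c, x = c * e ^ k := by
    intro x hx
    rcases exists_isUnit_mul_pow_or he n x with ⟨j, -, u, hu, rfl⟩ | ⟨c, rfl⟩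
    · have hj : e ^ j ∈ I := (Ideal.unit_mul_mem_iff_mem I hu).mp hx
      obtain ⟨d, hd⟩ := Nat.exists_eq_add_of_le (Nat.find_min' hI hj)
      refine ⟨u * e ^ d, ?_⟩
      rw [hd, pow_add]
      ring
    · exact ⟨0, by rw [hen]; simp⟩
  -- Here `I = (e ^ k)` and `n` is the nilpotency index. The value `g (e ^ k)` is killed by `e ^ (n
  -- - k)`, hence is a multiple of `e ^ k`.
  have hg : ∃ c, g ⟨e ^ k, hekI⟩ = c * e ^ k := by
    rcases exists_isUnit_mul_pow_or he n (g ⟨e ^ k, hekI⟩) with ⟨l, -, u, hu, hl⟩ | ⟨c, hc⟩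
    · have h0 : e ^ (n - k) • g ⟨e ^ k, hekI⟩ = 0 := by
        rw [← map_smul]
        convert map_zero g
        refine Subtype.ext (?_ : e ^ (n - k) * e ^ k = 0)
        rw [← pow_add, Nat.sub_add_cancel hkn, hen]
      rw [hl, smul_eq_mul, mul_left_comm, ← pow_add, hu.mul_right_eq_zero] at h0
      obtain ⟨d, hd⟩ := Nat.exists_eq_add_of_le (show k ≤ l by have := hlt _ h0; omega)
      refine ⟨u * e ^ d, ?_⟩
      rw [hl, hd, pow_add]
      ring
    · exact ⟨0, by rw [hc, hen]; simp⟩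
  obtain ⟨c, hc⟩ := hg
  refine ⟨LinearMap.mulLeft B c, fun x hx => ?_⟩
  obtain ⟨d, rfl⟩ := hgen x hx
  have : (⟨d * e ^ k, hx⟩ : I) = d • ⟨e ^ k, hekI⟩ := rfl
  rw [this, map_smul, hc, LinearMap.mulLeft_apply, smul_eq_mul]
  ring

end PrincipalMaximalIdeal

/-! ### A regular sequence among minimal generators -/

section Hypersurface

variable {R : Type u} [CommRing R] [IsLocalRing R]

/-- Steinitz exchange: as `z ∉ 𝔪 ^ 2 + I`, some coefficient of `z` on `es` is a unit, and that
generator can be traded for `z`. -/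
lemma exists_exchange {z : R} (I : Ideal R) (es : List R) (hes : ∀ a ∈ es, a ∈ maximalIdeal R)
    (hz : z ∈ I ⊔ Ideal.ofList es) (hz2 : z ∉ maximalIdeal R ^ 2 ⊔ I) :
    ∃ es', es'.length + 1 = es.length ∧
      I ⊔ Ideal.span {z} ⊔ Ideal.ofList es' = I ⊔ Ideal.ofList es := by
  induction es generalizing z with
  | nil => exact (hz2 (Ideal.mem_sup_right (by simpa using hz))).elim
  | cons a es ih =>
    have haz : z ∈ (I ⊔ Ideal.ofList es) ⊔ Ideal.span {a} := by
      rwa [Ideal.ofList_cons, sup_comm (Ideal.span {a}), ← sup_assoc] at hz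
    obtain ⟨x, hx, y, hy, rfl⟩ := Submodule.mem_sup.mp haz
    obtain ⟨c, rfl⟩ := Ideal.mem_span_singleton'.mp hy
    by_cases hc : IsUnit c
    · refine ⟨es, rfl, ?_⟩
      rw [Ideal.ofList_cons, sup_right_comm, sup_comm (Ideal.span {a}), ← sup_assoc]
      refine le_antisymm (sup_le le_sup_left ?_) (sup_le le_sup_left ?_)
      · rw [Ideal.span_singleton_le_iff_mem]
        exact haz
      · rw [Ideal.span_singleton_le_iff_mem, ← Ideal.unit_mul_mem_iff_mem _ hc,
          ← add_sub_cancel_left x (c * a)]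
        refine sub_mem (Ideal.mem_sup_right ?_) (Ideal.mem_sup_left hx)
        rw [add_sub_cancel_left]
        exact Ideal.mem_span_singleton_self _
    · have hca : c * a ∈ maximalIdeal R ^ 2 := by
        rw [pow_two]
        exact Ideal.mul_mem_mul hc (hes a (by simp))
      obtain ⟨es', hlen, h⟩ := ih (fun b hb => hes b (by simp [hb])) hx (fun hx2 =>
        hz2 (add_mem hx2 (Ideal.mem_sup_left hca)))
      refine ⟨a :: es', by simp [hlen], ?_⟩
      have h' : I ⊔ Ideal.span {x + c * a} ⊔ Ideal.ofList (a :: es') =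
          (I ⊔ Ideal.span {x} ⊔ Ideal.ofList es') ⊔ Ideal.span {a} := by
        rw [Ideal.ofList_cons]
        have : Ideal.span {x + c * a} ⊔ Ideal.span {a} = Ideal.span {x} ⊔ Ideal.span {a} := by
          rw [← Ideal.span_insert, ← Ideal.span_insert, Ideal.span_pair_add_mul_right]
        rw [← sup_assoc, sup_assoc I, this]
        simp only [sup_assoc, sup_comm (Ideal.ofList es')]
      rw [h', h, Ideal.ofList_cons, sup_comm (Ideal.span {a}), ← sup_assoc]

variable [IsNoetherianRing R]

/-- The maximal ideal of a hypersurface is generated by a regular sequence of length the depth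
and one more element. -/
lemma exists_isRegular_of_isHypersurface (h : IsHypersurface R) :
    ∃ rs : List R, IsRegular R rs ∧
      (∃ s, s ∉ Ideal.ofList rs ∧ ∀ a ∈ maximalIdeal R, a * s ∈ Ideal.ofList rs) ∧
      ∃ e, maximalIdeal R = Ideal.ofList rs ⊔ Ideal.span {e} := by
  -- Take the longest regular sequence that extends to a generating list of `𝔪` with at most `edim
  -- R` entries. A further regular element outside `𝔪 ^ 2 + (rs)` could be exchanged in, so none
  -- exists and a socle element appears.
  obtain ⟨rs, ⟨reg, es, hes, hlen⟩, hmax⟩ := exists_length_max (fun rs : List R => IsRegular R rs ∧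
      ∃ es, Ideal.ofList (rs ++ es) = maximalIdeal R ∧ (rs ++ es).length ≤ edim R) (edim R)
    (fun rs hrs => length_le_edim hrs.1) (rs₀ := []) (by
      obtain ⟨t, ht, hspan⟩ := Submodule.FG.exists_span_finset_card_eq_spanFinrank
        (maximalIdeal R).fg_of_isNoetherianRing
      refine ⟨.nil R R, t.toList, ?_, ?_⟩
      · simpa [Ideal.ofList] using hspan
      · rw [List.nil_append, Finset.length_toList, ht, edim_eq_spanFinrank])
  rw [Ideal.ofList_append] at hes
  obtain ⟨s, hsJ, hs⟩ := exists_socle_of_forall_zero_divisor (ofList_ne_top_of_isRegular reg) (by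
    intro z hz hz2
    by_contra! hreg
    obtain ⟨es', hl, hes'⟩ := exists_exchange (Ideal.ofList rs) es (fun a ha => hes.le
      (Ideal.mem_sup_right (Ideal.subset_span ha))) (by rwa [hes]) hz2
    have := hmax (rs ++ [z]) ⟨isRegular_append_singleton reg hz hreg, es', by
      rw [Ideal.ofList_append, Ideal.ofList_append, Ideal.ofList_singleton, hes', hes], by
      simp only [List.length_append, List.length_singleton] at hlen ⊢
      omega⟩
    simp at this)
  refine ⟨rs, reg, ⟨s, hsJ, hs⟩, ?_⟩
  -- The socle gives depth `|rs|`, so codepth at most one leaves at most one further generator; if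
  -- there is none, `e = 0`.
  rw [IsHypersurface, codepth, depth_eq_length_of_socle reg s hs hsJ, tsub_le_iff_left] at h
  have h' : edim R ≤ rs.length + 1 := by exact_mod_cast h
  rw [List.length_append] at hlen
  match es, hlen, hes with
  | [], _, hes => exact ⟨0, by rw [← hes]; simp⟩
  | [e], _, hes => exact ⟨e, by rw [← hes, Ideal.ofList_singleton]⟩
  | _ :: _ :: _, hlen, _ => simp at hlen; omega

end Hypersurface

end Burch

namespace Burch
open IsLocalRing RingTheory.Sequence Polynomial

/-! ### Presenting the artinian quotient by a Burch ideal -/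

section BurchPresentation

/-- If a local ring of dimension at least two with maximal ideal `(p, t)` maps onto a ring with
nilpotent maximal ideal generated by the image of `t`, then the kernel is a Burch ideal. -/
lemma isBurchIdeal_ker {S A : Type u} [CommRing S] [IsLocalRing S] [IsNoetherianRing S]
    [CommRing A] [IsLocalRing A] (ψ : S →+* A) (hψ : Function.Surjective ψ) {p t : S}
    (hn : maximalIdeal S = Ideal.span {p} ⊔ Ideal.span {t})
    (hA : maximalIdeal A = Ideal.span {ψ t}) (hnil : IsNilpotent (ψ t))
    (hdim : 2 ≤ (maximalIdeal S).height) : IsBurchIdeal (RingHom.ker ψ) := by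
  classical
  have hloc : IsLocalHom ψ := hψ.isLocalHom ψ
  -- As `ψ p` is a multiple of `ψ t`, replacing `p` by `f = p - a * t` puts a generator in the
  -- kernel.
  obtain ⟨f, hf, hnf⟩ : ∃ f ∈ RingHom.ker ψ,
      maximalIdeal S = Ideal.span {f} ⊔ Ideal.span {t} := by
    have hp : ψ p ∈ maximalIdeal A := by
      rw [mem_maximalIdeal, mem_nonunits_iff, isUnit_map_iff, ← mem_nonunits_iff,
        ← mem_maximalIdeal, hn]
      exact Ideal.mem_sup_left (Ideal.mem_span_singleton_self p)
    rw [hA, Ideal.mem_span_singleton'] at hp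
    obtain ⟨a, ha⟩ := hp
    obtain ⟨a, rfl⟩ := hψ a
    refine ⟨p - a * t, by rw [RingHom.mem_ker, map_sub, map_mul, ha, sub_self], ?_⟩
    rw [hn, ← Ideal.span_insert, ← Ideal.span_insert, ← neg_add_eq_sub, neg_mul_eq_neg_mul,
      add_comm, Ideal.span_pair_add_mul_right]
  have hfn : f ∈ maximalIdeal S := by
    rw [hnf]; exact Ideal.mem_sup_left (Ideal.mem_span_singleton_self f)
  have htn : t ∈ maximalIdeal S := by
    rw [hnf]; exact Ideal.mem_sup_right (Ideal.mem_span_singleton_self t)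
  obtain ⟨r, hr, hmin⟩ : ∃ r, ψ t ^ r = 0 ∧ ∀ k, ψ t ^ k = 0 → r ≤ k :=
    ⟨_, Nat.find_spec hnil, fun k hk => Nat.find_min' hnil hk⟩
  obtain ⟨r, rfl⟩ : ∃ r', r = r' + 1 := by
    refine Nat.exists_eq_succ_of_ne_zero ?_
    rintro rfl
    simp at hr
  -- With `r + 1` the nilpotency index of `ψ t`, the power `t ^ r` lies in the colon ideal. Equality
  -- of the two products would put `t ^ (r + 1)` in `𝔫` times the kernel.
  intro heq
  have ht : t ^ (r + 1) ∈ maximalIdeal S * RingHom.ker ψ := by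
    rw [heq, pow_succ']
    refine Ideal.mul_mem_mul htn (Submodule.mem_colon.mpr fun x hx => ?_)
    rw [SetLike.mem_coe, hnf] at hx
    obtain ⟨y, hy, z, hz, rfl⟩ := Submodule.mem_sup.mp hx
    obtain ⟨y, rfl⟩ := Ideal.mem_span_singleton'.mp hy
    obtain ⟨z, rfl⟩ := Ideal.mem_span_singleton'.mp hz
    rw [RingHom.mem_ker] at hf ⊢
    rw [smul_eq_mul, map_mul, map_add, map_mul, map_mul, hf, map_pow, mul_zero, zero_add,
      mul_left_comm, ← pow_succ, hr, mul_zero]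
  set q := Ideal.Quotient.mk (Ideal.span {f}) with hq
  have hqs : Function.Surjective q := Ideal.Quotient.mk_surjective
  have hB := isLocalRing_quotient (I := Ideal.span {f}) (fun h =>
    hfn (Ideal.span_singleton_eq_top.mp h))
  have hqloc : IsLocalHom q := hqs.isLocalHom q
  have hmB : maximalIdeal (S ⧸ Ideal.span {f}) = Ideal.span {q t} := by
    rw [← IsLocalRing.map_maximalIdeal_of_surjective q hqs, hnf, Ideal.map_sup, Ideal.map_span,
      Ideal.map_span, Set.image_singleton, Set.image_singleton,
      show q f = 0 from Ideal.Quotient.eq_zero_iff_mem.mpr (Ideal.mem_span_singleton_self f)]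
    simp
  have hker : (RingHom.ker ψ).map q ≤ Ideal.span {q t ^ (r + 1)} := by
    rw [Ideal.map_le_iff_le_comap]
    intro g hg
    rw [Ideal.mem_comap]
    rcases exists_isUnit_mul_pow_or hmB (r + 1) (q g) with ⟨k, hk, u, hu, h⟩ | ⟨c, h⟩
    · obtain ⟨u, rfl⟩ := hqs u
      have hu' : IsUnit u := isUnit_of_map_unit q u hu
      rw [← map_pow, ← map_mul, ← sub_eq_zero, ← map_sub, Ideal.Quotient.eq_zero_iff_mem] at h
      have h' : g - u * t ^ k ∈ RingHom.ker ψ :=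
        (Ideal.span_singleton_le_iff_mem _).mpr hf h
      rw [RingHom.mem_ker] at h' hg
      rw [map_sub, hg, zero_sub, neg_eq_zero, map_mul, (hu'.map ψ).mul_right_eq_zero, map_pow] at h'
      have := hmin k h'
      omega
    · rw [h]
      exact Ideal.mul_mem_left _ _ (Ideal.mem_span_singleton_self _)
  -- Modulo `f` the kernel lies in `(t ^ (r + 1))`, so `t ^ (r + 1)` becomes a multiple of `t ^ (r +
  -- 2)` and vanishes.
  have ht0 : q t ^ (r + 1) = 0 := by
    have h1 := Ideal.mem_map_of_mem q ht
    rw [Ideal.map_mul, IsLocalRing.map_maximalIdeal_of_surjective q hqs, map_pow] at h1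
    have h2 := Ideal.mul_mono_right (I := maximalIdeal (S ⧸ Ideal.span {f})) hker h1
    rw [hmB, Ideal.span_singleton_mul_span_singleton, Ideal.mem_span_singleton'] at h2
    obtain ⟨c, hc⟩ := h2
    have hu : IsUnit (1 - c * q t) := by
      by_contra h3
      refine (maximalIdeal.isMaximal (S ⧸ Ideal.span {f})).ne_top
        ((Ideal.eq_top_iff_one _).mpr ?_)
      rw [← sub_add_cancel 1 (c * q t)]
      exact add_mem h3 (by rw [hmB]; exact Ideal.mul_mem_left _ _ (Ideal.mem_span_singleton_self _))
    rw [← hu.mul_right_eq_zero]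
    linear_combination -hc
  -- Now `𝔫` is minimal over the principal ideal `(f)`, so its height is at most one, a
  -- contradiction.
  have hmin : maximalIdeal S ∈ (Ideal.span {f}).minimalPrimes := by
    refine ⟨⟨inferInstance, (Ideal.span_singleton_le_iff_mem _).mpr hfn⟩, fun J hJ _ => ?_⟩
    have := hJ.1
    rw [hnf, sup_le_iff]
    refine ⟨hJ.2, (Ideal.span_singleton_le_iff_mem _).mpr (hJ.1.mem_of_pow_mem (r + 1) (hJ.2 ?_))⟩
    rwa [← map_pow, Ideal.Quotient.eq_zero_iff_mem] at ht0
  have h1 := hdim.trans (Ideal.height_le_one_of_isPrincipal_of_mem_minimalPrimes _ _ hmin)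
  exact absurd h1 (by decide)

/-- Take `S = Λ[X]` localized at `(p, X)` and send `X` to `e`: constants reach the residue field,
and powers of `e` do the rest. -/
theorem exists_isBurchIdeal_of_ringHom {A : Type u} [CommRing A] [IsLocalRing A] {e : A}
    (he : maximalIdeal A = Ideal.span {e}) (hnil : IsNilpotent e)
    {Λ : Type u} [CommRing Λ] [IsDomain Λ] [IsDiscreteValuationRing Λ] (φ : Λ →+* A)
    (hφ : Function.Surjective ((residue A).comp φ)) :
    ∃ (S : Type u) (_ : CommRing S) (_ : IsRegularLocalRing S) (I : Ideal S),
      IsBurchIdeal I ∧ Nonempty (A ≃+* (S ⧸ I)) := by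
  have heA : e ∈ maximalIdeal A := by rw [he]; exact Ideal.mem_span_singleton_self e
  have hcomap : (maximalIdeal A).comap φ = maximalIdeal Λ := by
    have : (RingHom.ker ((residue A).comp φ)).IsMaximal :=
      RingHom.ker_isMaximal_of_surjective _ hφ
    rw [← IsLocalRing.eq_maximalIdeal this, ← RingHom.comap_ker, IsLocalRing.ker_residue]
  let ψ₀ : Λ[X] →+* A := Polynomial.eval₂RingHom φ e
  have hψ₀ : ∀ g, ψ₀ g ∈ maximalIdeal A ↔ g.coeff 0 ∈ maximalIdeal Λ := by
    intro g
    rw [← hcomap, Ideal.mem_comap]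
    conv_lhs => rw [← Polynomial.divX_mul_X_add g, map_add, map_mul]
    have h1 : ψ₀ X = e := Polynomial.eval₂_X _ _
    have h2 : ψ₀ (C (g.coeff 0)) = φ (g.coeff 0) := Polynomial.eval₂_C _ _
    rw [h1, h2]
    exact (maximalIdeal A).add_mem_iff_right (Ideal.mul_mem_left _ _ heA)
  let P : Ideal Λ[X] := (maximalIdeal A).comap ψ₀
  have hP : P.IsPrime := inferInstance
  have hPmem : ∀ g, g ∈ P ↔ g.coeff 0 ∈ maximalIdeal Λ := hψ₀
  have hreg : IsRegularLocalRing (Localization.AtPrime P) := by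
    refine Polynomial.isRegularLocalRing_localization_atPrime_of_comap_eq_maximalIdeal _ P ?_
    ext a
    rw [Ideal.mem_comap, hPmem, Polynomial.coeff_C_zero]
  let S := Localization.AtPrime P
  have hunit : ∀ y : P.primeCompl, IsUnit (ψ₀ y) := fun y => by
    by_contra h
    exact y.2 h
  let ψ : S →+* A := IsLocalization.lift hunit
  have hψ : ∀ g, ψ (algebraMap Λ[X] S g) = ψ₀ g := IsLocalization.lift_eq hunit
  -- Expand an element in powers of `e` with coefficients from `Λ`; nilpotency of `e` ends the
  -- process.
  have hψsurj : Function.Surjective ψ := by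
    have key : ∀ N, ∀ a, ∃ x, ∃ c, a = ψ x + c * e ^ N := by
      intro N
      induction N with
      | zero => exact fun a => ⟨0, a, by simp⟩
      | succ N ih =>
        intro a
        obtain ⟨x, c, rfl⟩ := ih a
        obtain ⟨l, hl⟩ := hφ (residue A c)
        have hl' : c - φ l ∈ maximalIdeal A := by
          rw [← IsLocalRing.ker_residue, RingHom.mem_ker, map_sub, ← hl, RingHom.comp_apply,
            sub_self]
        rw [he, Ideal.mem_span_singleton'] at hl'
        obtain ⟨d, hd⟩ := hl'
        refine ⟨x + algebraMap Λ[X] S (C l * X ^ N), d, ?_⟩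
        rw [map_add, hψ]
        have : ψ₀ (C l * X ^ N) = φ l * e ^ N := by
          simp [ψ₀]
        rw [this]
        linear_combination (-e ^ N) * hd
    intro a
    obtain ⟨N, hN⟩ := hnil
    obtain ⟨x, c, h⟩ := key N a
    exact ⟨x, by rw [h, hN]; simp⟩
  obtain ⟨p, hp⟩ := (IsPrincipalIdealRing.principal (maximalIdeal Λ)).principal
  have hPspan : P = Ideal.span {C p} ⊔ Ideal.span {X} := by
    refine le_antisymm (fun g hg => ?_) (sup_le ?_ ?_)
    · rw [hPmem, hp] at hg
      obtain ⟨c, hc⟩ := Ideal.mem_span_singleton'.mp hg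
      rw [← Polynomial.divX_mul_X_add g, ← hc, C_mul]
      exact add_mem (Ideal.mem_sup_right (Ideal.mul_mem_left _ _ (Ideal.mem_span_singleton_self _)))
        (Ideal.mem_sup_left (Ideal.mul_mem_left _ _ (Ideal.mem_span_singleton_self _)))
    · rw [Ideal.span_singleton_le_iff_mem, hPmem, coeff_C_zero, hp]
      exact Ideal.mem_span_singleton_self p
    · rw [Ideal.span_singleton_le_iff_mem, hPmem, coeff_X_zero]
      exact zero_mem _
  have hX : (Ideal.span {(X : Λ[X])}).IsPrime :=
    (Ideal.span_singleton_prime X_ne_zero).mpr Polynomial.prime_X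
  have hlt1 : (⊥ : Ideal Λ[X]) < Ideal.span {X} := by
    rw [bot_lt_iff_ne_bot, Ne, Ideal.span_singleton_eq_bot]
    exact X_ne_zero
  have hlt2 : Ideal.span {X} < P := by
    refine lt_of_le_of_ne (by rw [hPspan]; exact le_sup_right) fun h => ?_
    have h1 : C p ∈ Ideal.span {(X : Λ[X])} := by
      rw [h, hPspan]; exact Ideal.mem_sup_left (Ideal.mem_span_singleton_self _)
    rw [Ideal.mem_span_singleton, Polynomial.X_dvd_iff, coeff_C_zero] at h1
    refine IsDiscreteValuationRing.not_a_field Λ ?_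
    rw [hp, h1]
    simp
  have hheight : 2 ≤ (maximalIdeal S).height := by
    rw [← IsLocalization.height_under P.primeCompl, Localization.AtPrime.under_maximalIdeal]
    have h1 := Ideal.height_add_one_le_of_lt_of_isPrime hlt1
    have h2 := Ideal.height_add_one_le_of_lt_of_isPrime hlt2
    refine le_trans ?_ h2
    rw [← one_add_one_eq_two]
    gcongr
    exact le_trans le_add_self h1
  have hψX : ψ (algebraMap Λ[X] S X) = e := (hψ X).trans (Polynomial.eval₂_X _ _)
  refine ⟨S, inferInstance, hreg, RingHom.ker ψ, isBurchIdeal_ker ψ hψsurj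
    (p := algebraMap Λ[X] S (C p)) (t := algebraMap Λ[X] S X) ?_ (by rw [hψX, he])
    (by rwa [hψX]) hheight, ⟨(RingHom.quotientKerEquivOfSurjective hψsurj).symm⟩⟩
  refine (Localization.AtPrime.map_eq_maximalIdeal (I := P)).symm.trans
    ((congrArg (Ideal.map (algebraMap Λ[X] S)) hPspan).trans ?_)
  rw [Ideal.map_sup, Ideal.map_span, Ideal.map_span, Set.image_singleton, Set.image_singleton]

end BurchPresentation

end Burch

namespace Burch
open IsLocalRing RingTheory.Sequence Polynomial

/-! ### Coefficient fields and lifting along nilpotent ideals -/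

section CoefficientField

/-- By injectivity of Frobenius `X ^ p - c` has no root in `F`, so it is the minimal polynomial of
`π a`. It divides `g`, and it already vanishes at `a`. -/
lemma eval₂_eq_zero_of_forall_ne {F D k : Type*} [Field F] [CommRing D] [Field k] {p : ℕ}
    (hp : p.Prime) [CharP k p] (i : F →+* D) (π : D →+* k) (a : D) {c : F}
    (hc : i c = a ^ p) (ha : ∀ f, π (i f) ≠ π a) (g : F[X]) (hg : π (g.eval₂ i a) = 0) :
    g.eval₂ i a = 0 := by
  have := Fact.mk hp
  let := (π.comp i).toAlgebra
  have hirr : Irreducible (X ^ p - C c) := by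
    refine X_pow_sub_C_irreducible_of_prime hp fun b hb => ha b (frobenius_inj k p ?_)
    rw [frobenius_def, frobenius_def, ← map_pow, ← map_pow, ← map_pow, hb, hc]
  have hmin := minpoly.eq_of_irreducible_of_monic (x := π a) hirr (by
    rw [map_sub, map_pow, aeval_X, aeval_C, ← map_pow, ← hc]
    exact sub_self _) (monic_X_pow_sub_C c hp.ne_zero)
  have hdvd : X ^ p - C c ∣ g := by
    rw [hmin]
    refine minpoly.dvd F (π a) ?_
    rwa [Polynomial.hom_eval₂] at hg
  obtain ⟨q, rfl⟩ := hdvd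
  rw [eval₂_mul, eval₂_sub, eval₂_X_pow, eval₂_C, hc, sub_self, zero_mul]

/-- Existence of a coefficient field in characteristic `p` when `p`-th powers kill the kernel. -/
theorem exists_subring_bijective {D k : Type*} [CommRing D] [Field k] (p : ℕ) (hp : p.Prime)
    [CharP D p] [CharP k p] (π : D →+* k) (hπ : Function.Surjective π) (hker : ∀ d, π d = 0 → d ^ p = 0) :
    ∃ F : Subring D, Function.Bijective (π.comp F.subtype) := by
  have := Fact.mk hp
  -- Zorn's lemma on the subrings that contain all `p`-th powers and on which `π` is injective.
  obtain ⟨F, -, ⟨⟨hFp, hF0⟩, hmax⟩⟩ := zorn_le_nonempty₀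
    {F : Subring D | (frobenius D p).range ≤ F ∧ ∀ x ∈ F, π x = 0 → x = 0}
    (fun c hc hchain y hy => by
      have hdir : DirectedOn (· ≤ ·) c := hchain.directedOn
      refine ⟨sSup c, ⟨(hc hy).1.trans (le_sSup hy), fun x hx => ?_⟩, fun z hz => le_sSup hz⟩
      obtain ⟨F, hF, hxF⟩ := (Subring.mem_sSup_of_directedOn ⟨y, hy⟩ hdir).mp hx
      exact (hc hF).2 x hxF)
    (frobenius D p).range ⟨le_rfl, by
      rintro _ ⟨x, rfl⟩ hx
      rw [frobenius_def, map_pow, pow_eq_zero_iff hp.ne_zero] at hx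
      exact hker x hx⟩
  have hpF : ∀ d, d ^ p ∈ F := fun d => hFp ⟨d, rfl⟩
  have hfield : IsField F := by
    refine ⟨⟨0, 1, fun h => ?_⟩, mul_comm, fun {f} hf => ?_⟩
    · have := congrArg (fun x : F => π x) h
      simp at this
    · have hf' : π f ≠ 0 := fun h => hf (Subtype.ext (hF0 f f.2 h))
      obtain ⟨g, hg⟩ := hπ (π f)⁻¹
      -- With `π g = (π f)⁻¹`, the `p`-th power `g ^ p` lies in `F` and inverts `f ^ p`.
      refine ⟨f ^ (p - 1) * ⟨g ^ p, hpF g⟩, ?_⟩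
      rw [← mul_assoc, ← pow_succ', Nat.sub_add_cancel hp.one_le, ← sub_eq_zero]
      refine Subtype.ext (hF0 _ (Subtype.prop _) ?_)
      push_cast
      rw [map_sub, map_mul, map_pow, map_pow, hg, map_one, ← mul_pow, mul_inv_cancel₀ hf',
        one_pow, sub_self]
  refine ⟨F, fun x y hxy => Subtype.ext (sub_eq_zero.mp (hF0 _ (F.sub_mem x.2 y.2) ?_)), ?_⟩
  · rw [map_sub, sub_eq_zero]
    exact hxy
  · by_contra hns
    simp only [Function.Surjective, not_forall, not_exists] at hns
    obtain ⟨α, hα⟩ := hns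
    obtain ⟨a, rfl⟩ := hπ α
    let G : Subring D := (Polynomial.eval₂RingHom F.subtype a).range
    have hFG : F ≤ G := fun f hf => ⟨C ⟨f, hf⟩, Polynomial.eval₂_C _ _⟩
    have hG : ∀ x ∈ G, π x = 0 → x = 0 := by
      rintro _ ⟨g, rfl⟩ hg
      let := hfield.toField
      exact eval₂_eq_zero_of_forall_ne (F := F) hp F.subtype π a (c := ⟨a ^ p, hpF a⟩) rfl hα g hg
    have haF : a ∈ F := hmax ⟨hFp.trans hFG, hG⟩ hFG ⟨X, Polynomial.eval₂_X _ _⟩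
    exact hα ⟨a, haF⟩ rfl

/-- Rings with residue field `C / p = k` are lifted along square zero extensions killed by `p`. -/
theorem exists_lift_of_sq_zero {C k B B' : Type*} [CommRing C] [Field k] [CommRing B] [CommRing B']
    (p : ℕ) (hp : p.Prime) [CharP k p] (ρ : C →+* k) (hρ : Function.Surjective ρ)
    (hρp : ∀ c, ρ c = 0 → ∃ d, c = p * d) (hpC : ∀ c : C, p * c = 0 → c = 0) (g : B →+* B')
    (hg : Function.Surjective g) (hg2 : ∀ x y, g x = 0 → g y = 0 → x * y = 0)
    (hgp : ∀ x, g x = 0 → p * x = 0) (ψ : C →+* B') : ∃ ψ' : C →+* B, g.comp ψ' = ψ := by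
  -- `E` is the fibre product of `C` and `B` over `B'`. The ring `E / p E` maps onto `k` with kernel
  -- killed by squaring, so it has a coefficient field `F`.
  let E : Subring (C × B) := (ψ.comp (RingHom.fst C B)).eqLocus (g.comp (RingHom.snd C B))
  have hE : ∀ x : E, ψ x.1.1 = g x.1.2 := fun x => x.2
  let q := Ideal.Quotient.mk (Ideal.span {(p : E)})
  have hq : ∀ x : E, q x = 0 ↔ ∃ y : E, x.1.1 = p * y.1.1 ∧ x.1.2 = p * y.1.2 := by
    intro x
    rw [Ideal.Quotient.eq_zero_iff_mem, Ideal.mem_span_singleton]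
    refine exists_congr fun y => ?_
    rw [Subtype.ext_iff, Prod.ext_iff]
    simp
  have hqp : ∀ y : E, q (p * y) = 0 := fun y => (hq _).mpr ⟨y, rfl, rfl⟩
  let ρE : E →+* k := ρ.comp ((RingHom.fst C B).comp E.subtype)
  have hρE : ∀ x : E, ρE x = ρ x.1.1 := fun _ => rfl
  let π : E ⧸ Ideal.span {(p : E)} →+* k := Ideal.Quotient.lift _ ρE fun x hx => by
    obtain ⟨y, hy, -⟩ := (hq x).mp (Ideal.Quotient.eq_zero_iff_mem.mpr hx)
    rw [hρE, hy, map_mul, map_natCast, CharP.cast_eq_zero, zero_mul]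
  have hπ : ∀ x, π (q x) = ρ x.1.1 := fun _ => rfl
  have hlift : ∀ c, ∃ x : E, x.1.1 = c := fun c => by
    obtain ⟨b, hb⟩ := hg (ψ c)
    exact ⟨⟨(c, b), hb.symm⟩, rfl⟩
  have hD : CharP (E ⧸ Ideal.span {(p : E)}) p := by
    refine ⟨fun n => ⟨fun h => ?_, ?_⟩⟩
    · have := congrArg π h
      rwa [map_natCast, map_zero, CharP.cast_eq_zero_iff k p] at this
    · rintro ⟨m, rfl⟩
      rw [Nat.cast_mul, ← map_natCast q p,
        Ideal.Quotient.eq_zero_iff_mem.mpr (Ideal.mem_span_singleton_self _), zero_mul]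
  have hred : ∀ x : E, ρ x.1.1 = 0 → ∃ y : E, q y = q x ∧ y.1.1 = 0 ∧ g y.1.2 = 0 := by
    intro x hx
    obtain ⟨d, hd⟩ := hρp _ hx
    obtain ⟨y, rfl⟩ := hlift d
    have h0 : (x - p * y : E).1.1 = 0 := by
      change x.1.1 - p * y.1.1 = 0
      rw [hd, sub_self]
    refine ⟨x - p * y, ?_, h0, by rw [← hE, h0, map_zero]⟩
    rw [map_sub, hqp, sub_zero]
  obtain ⟨F, hF⟩ := exists_subring_bijective p hp π (fun α => by
    obtain ⟨c, rfl⟩ := hρ α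
    obtain ⟨x, rfl⟩ := hlift c
    exact ⟨q x, rfl⟩) (fun d hd => by
    obtain ⟨x, rfl⟩ := Ideal.Quotient.mk_surjective d
    obtain ⟨y, hy, hy1, hy2⟩ := hred x hd
    have hyy : y ^ 2 = 0 := by
      rw [pow_two]
      exact Subtype.ext (Prod.ext (by change y.1.1 * y.1.1 = 0; rw [hy1, zero_mul])
        (hg2 _ _ hy2 hy2))
    change q x ^ p = 0
    rw [← hy, ← map_pow, pow_eq_zero_of_le hp.two_le hyy, map_zero])
  let h : F.comap q →+* C := (RingHom.fst C B).comp (E.subtype.comp (F.comap q).subtype)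
  have hh : ∀ x, h x = x.1.1.1 := fun _ => rfl
  -- The preimage of `F` in `E` is a copy of `C`; inverting `h` and projecting to `B` gives the
  -- lift. Injectivity uses that `C` has no `p`-torsion and that `p` kills the kernel of `g`.
  have hbij : Function.Bijective h := by
    refine ⟨(injective_iff_map_eq_zero h).mpr fun x hx => ?_, fun c => ?_⟩
    · rw [hh] at hx
      have h0 : (⟨q x.1, x.2⟩ : F) = 0 := by
        refine hF.1 ?_
        change π (q x.1) = (π.comp F.subtype) 0
        rw [hπ, hx, map_zero, map_zero]
      obtain ⟨y, hy1, hy2⟩ := (hq x.1).mp (congrArg Subtype.val h0)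
      have hy0 : y.1.1 = 0 := hpC _ (by rw [← hy1, hx])
      have hx2 : x.1.1.2 = 0 := by
        rw [hy2]
        exact hgp _ (by rw [← hE, hy0, map_zero])
      exact Subtype.ext (Subtype.ext (Prod.ext hx hx2))
    · obtain ⟨⟨d, hdF⟩, hd⟩ := hF.2 (ρ c)
      obtain ⟨x, rfl⟩ := Ideal.Quotient.mk_surjective d
      have hd' : ρ x.1.1 = ρ c := hd
      obtain ⟨e, he⟩ := hρp (c - x.1.1) (by rw [map_sub, hd', sub_self])
      obtain ⟨y, rfl⟩ := hlift e
      refine ⟨⟨x + p * y, ?_⟩, ?_⟩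
      · rw [Subring.mem_comap, map_add, hqp, add_zero]
        exact hdF
      · change x.1.1 + p * y.1.1 = c
        rw [← he, add_sub_cancel]
  let e := RingEquiv.ofBijective h hbij
  refine ⟨((RingHom.snd C B).comp (E.subtype.comp (F.comap q).subtype)).comp e.symm.toRingHom, ?_⟩
  ext c
  obtain ⟨x, rfl⟩ := e.surjective c
  have : e.symm.toRingHom (e x) = x := e.symm_apply_apply x
  rw [RingHom.comp_apply, RingHom.comp_apply, this]
  exact (hE x.1).symm

/-- Lift through the square-zero extensions `A / 𝔪 ^ (n + 2) → A / 𝔪 ^ (n + 1)`, whose kernels are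
killed by `p ∈ 𝔪`, until the power vanishes. -/
theorem exists_lift_residue {C A : Type*} [CommRing C] [CommRing A] [IsLocalRing A]
    (hnil : IsNilpotent (maximalIdeal A)) (p : ℕ) (hp : p.Prime) [CharP (ResidueField A) p]
    (ρ : C →+* ResidueField A) (hρ : Function.Surjective ρ)
    (hρp : ∀ c, ρ c = 0 → ∃ d, c = p * d) (hpC : ∀ c : C, p * c = 0 → c = 0) :
    ∃ φ : C →+* A, (residue A).comp φ = ρ := by
  have key : ∀ n, ∀ I, I = maximalIdeal A ^ (n + 1) →
      ∃ φ : C →+* A ⧸ I, ∀ c a, Ideal.Quotient.mk I a = φ c → residue A a = ρ c := by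
    intro n
    induction n with
    | zero =>
      rintro I rfl
      rw [zero_add, pow_one]
      exact ⟨ρ, fun c a h => h⟩
    | succ n ih =>
      rintro I rfl
      obtain ⟨ψ, hψ⟩ := ih _ rfl
      have hle : maximalIdeal A ^ (n + 1 + 1) ≤ maximalIdeal A ^ (n + 1) :=
        Ideal.pow_le_pow_right (Nat.le_succ _)
      have hker : ∀ x, Ideal.Quotient.factor hle x = 0 →
          ∃ a ∈ maximalIdeal A ^ (n + 1), Ideal.Quotient.mk _ a = x := by
        intro x hx
        obtain ⟨a, rfl⟩ := Ideal.Quotient.mk_surjective x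
        rw [Ideal.Quotient.factor_mk, Ideal.Quotient.eq_zero_iff_mem] at hx
        exact ⟨a, hx, rfl⟩
      have hpm : (p : A) ∈ maximalIdeal A := by
        rw [← IsLocalRing.ker_residue, RingHom.mem_ker, map_natCast, CharP.cast_eq_zero]
      obtain ⟨φ, hφ⟩ := exists_lift_of_sq_zero p hp ρ hρ hρp hpC (Ideal.Quotient.factor hle)
        (Ideal.Quotient.factor_surjective hle) (fun x y hx hy => by
          obtain ⟨a, ha, rfl⟩ := hker x hx
          obtain ⟨b, hb, rfl⟩ := hker y hy
          rw [← map_mul, Ideal.Quotient.eq_zero_iff_mem]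
          have := Ideal.mul_mem_mul ha hb
          rw [← pow_add] at this
          exact Ideal.pow_le_pow_right (by omega) this) (fun x hx => by
          obtain ⟨a, ha, rfl⟩ := hker x hx
          rw [← map_natCast (Ideal.Quotient.mk _) p, ← map_mul, Ideal.Quotient.eq_zero_iff_mem,
            pow_succ']
          exact Ideal.mul_mem_mul hpm ha) ψ
      refine ⟨φ, fun c a h => hψ c a ?_⟩
      rw [← hφ, RingHom.comp_apply, ← h, Ideal.Quotient.factor_mk]
  obtain ⟨N, hN⟩ := hnil
  obtain ⟨φ, hφ⟩ := key N ⊥ (by rw [pow_succ, hN]; simp)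
  refine ⟨(RingEquiv.quotientBot A).toRingHom.comp φ, ?_⟩
  ext c
  refine hφ c _ ?_
  obtain ⟨a, ha⟩ := Ideal.Quotient.mk_surjective (φ c)
  rw [RingHom.comp_apply, ← ha]
  rfl

/-- Existence of a coefficient field in equal characteristic zero. -/
theorem exists_section_residue_of_charZero {A : Type*} [CommRing A] [IsLocalRing A]
    (hnil : IsNilpotent (maximalIdeal A)) [CharZero (ResidueField A)] :
    ∃ φ : ResidueField A →+* A, (residue A).comp φ = RingHom.id _ := by
  have hQ : Nonempty (Algebra ℚ A) := by
    refine (EqualCharZero.nonempty_algebraRat_iff A).mpr fun I hI => ⟨fun m n h => ?_⟩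
    have := congrArg (Ideal.Quotient.factor (IsLocalRing.le_maximalIdeal hI)) h
    rw [map_natCast, map_natCast] at this
    exact Nat.cast_injective (R := ResidueField A) this
  obtain ⟨hQ⟩ := hQ
  obtain ⟨s, hs⟩ := exists_isTranscendenceBasis ℚ (ResidueField A)
  have := hs.isAlgebraic_field
  -- The residue field is separable algebraic over `ℚ(s)`, hence formally smooth over `ℚ`, so its
  -- identity map lifts along the nilpotent ideal.
  have : Algebra.FormallySmooth ℚ (ResidueField A) :=
    Algebra.FormallySmooth.of_algebraicIndependent_of_isSeparable hs.1
  obtain ⟨f, hf⟩ := Algebra.FormallySmooth.exists_lift (maximalIdeal A) hnil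
    (RingHom.toRatAlgHom (RingHom.id (ResidueField A) : ResidueField A →+* A ⧸ maximalIdeal A))
  exact ⟨f, RingHom.ext fun x => AlgHom.congr_fun hf x⟩

end CoefficientField

end Burch

namespace Burch
open IsLocalRing RingTheory.Sequence Polynomial

/-! ### Construction of a discrete valuation ring with uniformizer `p` -/

section CohenRing

/-- Every root of the reduction of a monic polynomial over a valuation ring of an algebraically
closed field lifts to a root. -/
lemma exists_root_of_residue_root {L : Type*} [Field L] [IsAlgClosed L] (O : ValuationSubring L)
    (n : ℕ) (F : O[X]) (hF : F.Monic) (hn : F.natDegree = n) (α : ResidueField O)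
    (hα : F.eval₂ (residue O) α = 0) : ∃ a, F.eval a = 0 ∧ residue O a = α := by
  induction n generalizing F with
  | zero =>
    rw [hF.natDegree_eq_zero.mp hn] at hα
    simp at hα
  | succ n ih =>
    have hdeg : (F.map (algebraMap O L)).degree ≠ 0 := by
      rw [hF.degree_map, Polynomial.degree_eq_natDegree hF.ne_zero, hn]
      exact_mod_cast Nat.succ_ne_zero n
    -- A root in `L` is integral, so it lies in `O`. Either it reduces to `α`, or it is split off
    -- and induction applies.
    obtain ⟨b, hb⟩ := IsAlgClosed.exists_root _ hdeg
    have hbint : IsIntegral O b := ⟨F, hF, by rwa [IsRoot.def, eval_map] at hb⟩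
    obtain ⟨a, rfl⟩ := IsIntegrallyClosed.isIntegral_iff.mp hbint
    have ha : F.IsRoot a := by
      rw [IsRoot.def, eval_map, eval₂_at_apply] at hb
      exact (map_eq_zero_iff _ (IsFractionRing.injective O L)).mp hb
    have hmul := mul_divByMonic_eq_iff_isRoot.mpr ha
    have hQ : (F /ₘ (X - C a)).Monic := by
      refine (monic_X_sub_C a).of_mul_monic_left ?_
      rwa [hmul]
    have hQn : (F /ₘ (X - C a)).natDegree = n := by
      rw [natDegree_divByMonic _ (monic_X_sub_C a), hn, natDegree_X_sub_C, Nat.add_sub_cancel]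
    rw [← hmul, eval₂_mul, mul_eq_zero, eval₂_sub, eval₂_X, eval₂_C, sub_eq_zero] at hα
    rcases hα with h | h
    · exact ⟨a, ha, h.symm⟩
    · obtain ⟨c, hc, hcα⟩ := ih _ hQ hQn h
      exact ⟨c, by rw [← hmul, eval_mul, hc, mul_zero], hcα⟩

/-- If `α` is algebraic over the image of `C`, let `a` be a root of a monic lift `f` of its minimal
polynomial: a relation `g` is `f * q` plus a multiple of `p`. If `α` is transcendental, any lift
works, since `g` itself is a multiple of `p`. -/
lemma exists_lift_of_forall_root {C O κ : Type*} [CommRing C] [CommRing O] [Field κ] (ι : C →+* O)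
    (res : O →+* κ) (hres : Function.Surjective res) (p : ℕ)
    (hunit : ∀ c, res (ι c) ≠ 0 → IsUnit c) (hp : ∀ c, res (ι c) = 0 → ∃ d, c = p * d)
    (hroot : ∀ f : C[X], f.Monic → ∀ α, f.eval₂ (res.comp ι) α = 0 →
      ∃ a, f.eval₂ ι a = 0 ∧ res a = α) (α : κ) :
    ∃ a, res a = α ∧ ∀ g : C[X], res (g.eval₂ ι a) = 0 →
      ∃ h : C[X], g.eval₂ ι a = p * h.eval₂ ι a := by
  let I := RingHom.ker (res.comp ι)
  have hI : I.IsMaximal := by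
    refine Ideal.isMaximal_iff.mpr ⟨fun h => ?_, fun J c _ hc hcJ => ?_⟩
    · rw [RingHom.mem_ker, map_one] at h
      exact one_ne_zero h
    · exact (Ideal.eq_top_iff_one J).mp (J.eq_top_of_isUnit_mem hcJ (hunit c hc))
  let := Ideal.Quotient.field I
  let := (RingHom.kerLift (res.comp ι)).toAlgebra
  let τ : C →+* C ⧸ I := Ideal.Quotient.mk I
  have hτ : Function.Surjective τ := Ideal.Quotient.mk_surjective
  have hστ : (algebraMap (C ⧸ I) κ).comp τ = res.comp ι := RingHom.ext fun c => rfl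
  have haeval : ∀ (g : C[X]) (β : κ), aeval β (g.map τ) = g.eval₂ (res.comp ι) β := by
    intro g β
    rw [aeval_def, eval₂_map, hστ]
  have hmap : ∀ g : C[X], g.map τ = 0 → ∃ h : C[X], g = Polynomial.C (p : C) * h := by
    intro g hg
    refine (C_dvd_iff_dvd_coeff _ _).mpr fun n => ?_
    refine hp _ ?_
    have := congrArg (fun q => q.coeff n) hg
    simp only [coeff_map, coeff_zero] at this
    exact Ideal.Quotient.eq_zero_iff_mem.mp this
  by_cases hα : IsIntegral (C ⧸ I) α
  · obtain ⟨f, hf, -, hfm⟩ := lifts_and_natDegree_eq_and_monic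
      ((mem_lifts _).mpr (map_surjective τ hτ (minpoly (C ⧸ I) α))) (minpoly.monic hα)
    obtain ⟨a, ha, haα⟩ := hroot f hfm α (by rw [← haeval, hf, minpoly.aeval])
    refine ⟨a, haα, fun g hg => ?_⟩
    rw [hom_eval₂, haα, ← haeval] at hg
    obtain ⟨q, hq⟩ := minpoly.dvd _ _ hg
    obtain ⟨q, rfl⟩ := map_surjective τ hτ q
    obtain ⟨h, hh⟩ := hmap (g - f * q) (by rw [Polynomial.map_sub, Polynomial.map_mul, hf, hq,
      sub_self])
    refine ⟨h, ?_⟩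
    rw [← sub_add_cancel g (f * q), hh, eval₂_add, eval₂_mul, eval₂_mul, ha, eval₂_C, map_natCast,
      zero_mul, add_zero]
  · obtain ⟨a, ha⟩ := hres α
    refine ⟨a, ha, fun g hg => ?_⟩
    rw [hom_eval₂, ha, ← haeval] at hg
    rw [← isAlgebraic_iff_isIntegral] at hα
    obtain ⟨h, rfl⟩ := hmap g (by
      by_contra h0
      exact hα ⟨_, h0, hg⟩)
    exact ⟨h, by rw [eval₂_mul, eval₂_C, map_natCast]⟩

/-- Every field is contained in the residue field of a valuation ring of characteristic zero of an
algebraically closed field. -/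
lemma exists_valuationSubring (k : Type u) [Field k] :
    ∃ (L : Type u) (_ : Field L) (_ : IsAlgClosed L) (_ : CharZero L) (O : ValuationSubring L),
      Nonempty (k →+* ResidueField O) := by
  -- A characteristic zero domain mapping onto `k`: one variable per element. A valuation ring
  -- dominating its localization at the kernel has a residue field containing `k`.
  let M := MvPolynomial k ℤ
  let ev : M →+* k := MvPolynomial.eval₂Hom (Int.castRingHom k) id
  have hev : Function.Surjective ev := fun a => ⟨MvPolynomial.X a, MvPolynomial.eval₂Hom_X' _ _ a⟩
  let P := RingHom.ker ev
  have hP : P.IsPrime := RingHom.ker_isPrime ev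
  let L := AlgebraicClosure (FractionRing M)
  have hML : Function.Injective (algebraMap M L) := by
    rw [IsScalarTower.algebraMap_eq M (FractionRing M) L]
    exact (algebraMap (FractionRing M) L).injective.comp (IsFractionRing.injective M _)
  have hL : CharZero L := by
    have : CharZero (FractionRing M) := inferInstance
    exact inferInstance
  have hy : ∀ y : P.primeCompl, IsUnit (ev y) := fun y => isUnit_iff_ne_zero.mpr y.2
  have hyL : ∀ y : P.primeCompl, IsUnit (algebraMap M L y) := fun y =>
    isUnit_iff_ne_zero.mpr fun h => y.2 (by
      rw [(map_eq_zero_iff _ hML).mp h]; exact zero_mem _)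
  let ρ : Localization.AtPrime P →+* k := IsLocalization.lift hy
  have hρ : Function.Surjective ρ := fun a => by
    obtain ⟨x, rfl⟩ := hev a
    exact ⟨algebraMap _ _ x, IsLocalization.lift_eq hy x⟩
  obtain ⟨O, hO, hloc⟩ := IsLocalRing.exists_factor_valuationRing
    (IsLocalization.lift hyL : Localization.AtPrime P →+* L)
  let j : Localization.AtPrime P →+* O := RingHom.codRestrict _ O.toSubring hO
  have hj : IsLocalHom j := hloc
  have hker : RingHom.ker ρ ≤ RingHom.ker ((residue O).comp j) := by
    intro x hx
    rw [← RingHom.comap_ker, IsLocalRing.ker_residue, Ideal.mem_comap]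
    intro hu
    have := (isUnit_of_map_unit j x hu).map ρ
    rw [hx] at this
    exact not_isUnit_zero this
  exact ⟨L, inferInstance, inferInstance, hL, O,
    ⟨RingHom.liftOfSurjective ρ hρ ⟨(residue O).comp j, hker⟩⟩⟩

/-- Zorn's lemma: a maximal subring with residues in `k` and residue kernel generated by `p` admits
neither new inverses nor new residues. -/
lemma exists_subring_of_valuationSubring {k L : Type*} [Field k] [Field L] [IsAlgClosed L]
    (O : ValuationSubring L) (i : k →+* ResidueField O) (p : ℕ) [CharP k p] :
    ∃ C : Subring O, (∀ c ∈ C, residue O c = 0 → ∃ d ∈ C, c = p * d) ∧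
      (∀ c ∈ C, residue O c ≠ 0 → ∃ d ∈ C, c * d = 1) ∧ (∀ c ∈ C, residue O c ∈ i.range) ∧
      ∀ α, ∃ c ∈ C, residue O c = i α := by
  have hκ : CharP (ResidueField O) p := charP_of_injective_ringHom i.injective p
  obtain ⟨C, -, ⟨⟨hC0, hCk⟩, hmax⟩⟩ := zorn_le_nonempty₀
    {C : Subring O | (∀ c ∈ C, residue O c = 0 → ∃ d ∈ C, c = p * d) ∧
      ∀ c ∈ C, residue O c ∈ i.range}
    (fun c hc hchain y hy => by
      have hdir : DirectedOn (· ≤ ·) c := hchain.directedOn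
      refine ⟨sSup c, ⟨fun x hx hx0 => ?_, fun x hx => ?_⟩, fun z hz => le_sSup hz⟩
      · obtain ⟨F, hF, hxF⟩ := (Subring.mem_sSup_of_directedOn ⟨y, hy⟩ hdir).mp hx
        obtain ⟨d, hd, h⟩ := (hc hF).1 x hxF hx0
        exact ⟨d, le_sSup hF hd, h⟩
      · obtain ⟨F, hF, hxF⟩ := (Subring.mem_sSup_of_directedOn ⟨y, hy⟩ hdir).mp hx
        exact (hc hF).2 x hxF)
    (Int.castRingHom O).range ⟨by
      rintro _ ⟨n, rfl⟩ hn
      rw [eq_intCast, map_intCast, CharP.intCast_eq_zero_iff _ p] at hn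
      obtain ⟨m, rfl⟩ := hn
      exact ⟨m, ⟨m, by simp⟩, by simp⟩, by
      rintro _ ⟨n, rfl⟩
      exact ⟨n, by simp⟩⟩
  have hunit : ∀ c ∈ C, residue O c ≠ 0 → ∃ d ∈ C, c * d = 1 := by
    intro c hcC hc
    obtain ⟨d, hd⟩ := isUnit_iff_exists_inv.mp ((residue_ne_zero_iff_isUnit c).mp hc)
    have hcd : ∀ n, c ^ n * d ^ n = 1 := fun n => by rw [← mul_pow, hd, one_pow]
    -- This is `C[c⁻¹]` inside `O`. It keeps both Zorn conditions, so maximality puts `d = c⁻¹` in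
    -- `C`.
    let C' : Subring O :=
      { carrier := {x | ∃ n, x * c ^ n ∈ C}
        mul_mem' := by
          rintro x y ⟨n, hn⟩ ⟨m, hm⟩
          refine ⟨n + m, ?_⟩
          rw [pow_add, mul_mul_mul_comm]
          exact C.mul_mem hn hm
        one_mem' := ⟨0, by simp⟩
        add_mem' := by
          rintro x y ⟨n, hn⟩ ⟨m, hm⟩
          refine ⟨n + m, ?_⟩
          have := C.add_mem (C.mul_mem hn (C.pow_mem hcC m)) (C.mul_mem hm (C.pow_mem hcC n))
          convert this using 1
          ring
        zero_mem' := ⟨0, by simp⟩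
        neg_mem' := by
          rintro x ⟨n, hn⟩
          exact ⟨n, by rw [neg_mul]; exact C.neg_mem hn⟩ }
    have hCC' : C ≤ C' := fun x hx => ⟨0, by simpa using hx⟩
    refine ⟨d, hmax (y := C') ⟨?_, ?_⟩ hCC' ⟨1, by rw [pow_one, mul_comm, hd]; exact C.one_mem⟩, hd⟩
    · rintro x ⟨n, hn⟩ hx
      obtain ⟨e, he, hxe⟩ := hC0 _ hn (by rw [map_mul, hx, zero_mul])
      refine ⟨e * d ^ n, ⟨n, ?_⟩, ?_⟩
      · rwa [mul_assoc, mul_comm (d ^ n), hcd, mul_one]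
      · rw [← mul_assoc, ← hxe, mul_assoc, hcd, mul_one]
    · rintro x ⟨n, hn⟩
      obtain ⟨a, ha⟩ := hCk _ hn
      obtain ⟨b, hb⟩ := hCk _ (C.pow_mem hcC n)
      refine ⟨a * b⁻¹, ?_⟩
      rw [map_mul, map_inv₀, ha, hb, map_mul, mul_assoc, mul_inv_cancel₀, mul_one]
      rw [map_pow]
      exact pow_ne_zero n hc
  refine ⟨C, hC0, hunit, hCk, fun α => ?_⟩
  obtain ⟨a, ha, hlift⟩ := exists_lift_of_forall_root C.subtype (residue O) (residue_surjective) p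
    (fun c hc => by
      obtain ⟨d, hd, hcd⟩ := hunit c c.2 hc
      exact IsUnit.of_mul_eq_one ⟨d, hd⟩ (Subtype.ext hcd))
    (fun c hc => by
      obtain ⟨d, hd, hcd⟩ := hC0 c c.2 hc
      exact ⟨⟨d, hd⟩, Subtype.ext hcd⟩)
    (fun f hf β hβ => by
      obtain ⟨a, ha, h⟩ := exists_root_of_residue_root O _ (f.map C.subtype) (hf.map _) rfl β
        (by rwa [eval₂_map])
      exact ⟨a, by rwa [eval_map] at ha, h⟩) (i α)
  let C' : Subring O := (Polynomial.eval₂RingHom C.subtype a).range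
  have hCC' : C ≤ C' := fun f hf => ⟨Polynomial.C ⟨f, hf⟩, Polynomial.eval₂_C _ _⟩
  refine ⟨a, hmax (y := C') ⟨?_, ?_⟩ hCC' ⟨X, Polynomial.eval₂_X _ _⟩, ha⟩
  · rintro _ ⟨g, rfl⟩ hg
    obtain ⟨h, hh⟩ := hlift g hg
    exact ⟨_, ⟨h, rfl⟩, hh⟩
  · rintro _ ⟨g, rfl⟩
    rw [coe_eval₂RingHom, hom_eval₂, ha, eval₂_eq_sum_range]
    exact Subring.sum_mem _ fun n _ => Subring.mul_mem _ (hCk _ (g.coeff n).2)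
      (Subring.pow_mem i.range (RingHom.mem_range_self i α) n)

/-- Every field of characteristic `p` is the residue field of a local domain of characteristic zero
with maximal ideal `(p)`. -/
lemma exists_isDomain_residue (k : Type u) [Field k] (p : ℕ) (hp : p.Prime) [CharP k p] :
    ∃ (C : Type u) (_ : CommRing C) (_ : IsDomain C) (ρ : C →+* k), Function.Surjective ρ ∧
      (∀ c, ρ c = 0 → ∃ d, c = p * d) ∧ (∀ c, ρ c ≠ 0 → IsUnit c) ∧ (p : C) ≠ 0 := by
  obtain ⟨L, _, _, _, O, ⟨i⟩⟩ := exists_valuationSubring k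
  obtain ⟨C, hC0, hunit, hCk, hkC⟩ := exists_subring_of_valuationSubring O i p
  choose ρ hρ using fun c : C => hCk c c.2
  have hinj := i.injective
  let ρ' : C →+* k :=
    { toFun := ρ
      map_one' := hinj (by rw [hρ]; simp)
      map_mul' := fun x y => hinj (by rw [hρ, map_mul, hρ, hρ]; simp)
      map_zero' := hinj (by rw [hρ]; simp)
      map_add' := fun x y => hinj (by rw [hρ, map_add, hρ, hρ]; simp) }
  have hρ' : ∀ c, i (ρ' c) = residue O c := hρ
  refine ⟨C, inferInstance, inferInstance, ρ', fun α => ?_, fun c hc => ?_, fun c hc => ?_,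
    fun h => ?_⟩
  · obtain ⟨c, hc, h⟩ := hkC α
    exact ⟨⟨c, hc⟩, hinj (by rw [hρ', h])⟩
  · obtain ⟨d, hd, h⟩ := hC0 c c.2 (by rw [← hρ', hc, map_zero])
    exact ⟨⟨d, hd⟩, Subtype.ext h⟩
  · obtain ⟨d, hd, h⟩ := hunit c c.2 (by rwa [← hρ', Ne, map_eq_zero])
    exact IsUnit.of_mul_eq_one ⟨d, hd⟩ (Subtype.ext h)
  · have := congrArg (fun x : C => ((x : O) : L)) h
    simp only [SubringClass.coe_natCast, ZeroMemClass.coe_zero] at this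
    simp [hp.ne_zero] at this

/-- Every field of characteristic `p` is the residue field of a discrete valuation ring with
uniformizer `p ≠ 0`. -/
theorem exists_isDiscreteValuationRing_residue (k : Type u) [Field k] (p : ℕ) (hp : p.Prime)
    [CharP k p] :
    ∃ (Λ : Type u) (_ : CommRing Λ) (_ : IsDomain Λ) (_ : IsDiscreteValuationRing Λ)
      (ρ : Λ →+* k), Function.Surjective ρ ∧ (∀ c, ρ c = 0 → ∃ d, c = p * d) ∧ (p : Λ) ≠ 0 := by
  obtain ⟨C, _, _, ρ, hρ, hρp, hunit, hp0⟩ := exists_isDomain_residue k p hp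
  have hρp0 : ρ p = 0 := by rw [map_natCast, CharP.cast_eq_zero]
  -- `C` need not be `p`-adically separated. Outside `I` every element is a unit times a power of
  -- `p`, so `I` is prime and `C ⧸ I` is a discrete valuation ring.
  let I : Ideal C := ⨅ n, Ideal.span {(p : C) ^ n}
  have hImem : ∀ c, c ∈ I ↔ ∀ n, (p : C) ^ n ∣ c := fun c => by
    simp only [I, Submodule.mem_iInf, Ideal.mem_span_singleton]
  have hpow : ∀ n (u : C), IsUnit u → u * p ^ n ∉ I := by
    intro n u hu h
    obtain ⟨d, hd⟩ := (hImem _).mp h (n + 1)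
    have h1 : u = p * d := by
      refine mul_left_cancel₀ (pow_ne_zero n hp0) ?_
      linear_combination hd
    have h2 := hu.map ρ
    rw [h1, map_mul, hρp0, zero_mul] at h2
    exact not_isUnit_zero h2
  have hfact : ∀ c, c ∉ I → ∃ n u, IsUnit u ∧ c = u * p ^ n := by
    intro c hc
    classical
    have hex : ∃ n, ¬ (p : C) ^ n ∣ c := by
      by_contra! h
      exact hc ((hImem c).mpr h)
    obtain ⟨n, hn⟩ := Nat.exists_eq_succ_of_ne_zero (n := Nat.find hex) (fun h => by
      have := Nat.find_spec hex
      rw [h, pow_zero] at this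
      exact this (one_dvd c))
    obtain ⟨d, rfl⟩ := not_not.mp (Nat.find_min hex (m := n) (by omega))
    refine ⟨n, d, hunit d fun hd => ?_, mul_comm _ _⟩
    obtain ⟨e, rfl⟩ := hρp d hd
    have := Nat.find_spec hex
    rw [hn, Nat.succ_eq_add_one, pow_succ] at this
    exact this (mul_dvd_mul_left _ (dvd_mul_right _ _))
  have hI : I.IsPrime := by
    refine ⟨(Ideal.ne_top_iff_one I).mpr (by simpa using hpow 0 1 isUnit_one), ?_⟩
    intro x y hxy
    by_contra! h
    obtain ⟨n, u, hu, rfl⟩ := hfact x h.1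
    obtain ⟨m, v, hv, rfl⟩ := hfact y h.2
    refine hpow (n + m) (u * v) (hu.mul hv) ?_
    convert hxy using 1
    ring
  let q := Ideal.Quotient.mk I
  have hq : ∀ c, q c = 0 ↔ c ∈ I := fun c => Ideal.Quotient.eq_zero_iff_mem
  let ρ' : C ⧸ I →+* k := Ideal.Quotient.lift I ρ fun c hc => by
    obtain ⟨d, rfl⟩ := (hImem c).mp hc 1
    rw [map_mul, pow_one, hρp0, zero_mul]
  have hρ' : ∀ c, ρ' (q c) = ρ c := fun c => Ideal.Quotient.lift_mk _ _ _
  have hqp : q p ≠ 0 := by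
    rw [Ne, hq]
    simpa using hpow 1 1 isUnit_one
  have hρ'p : ∀ c, ρ' c = 0 → ∃ d, c = q p * d := by
    intro c hc
    obtain ⟨c, rfl⟩ := Ideal.Quotient.mk_surjective c
    obtain ⟨d, rfl⟩ := hρp c (by rwa [← hρ'])
    exact ⟨q d, map_mul q _ _⟩
  have hunit' : ∀ c, ρ' c ≠ 0 → IsUnit c := by
    intro c hc
    obtain ⟨c, rfl⟩ := Ideal.Quotient.mk_surjective c
    exact (hunit c (by rwa [← hρ'])).map q
  have hirr : Irreducible (q p) := by
    refine ⟨fun h => ?_, fun a b hab => ?_⟩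
    · have := h.map ρ'
      rw [hρ', hρp0] at this
      exact not_isUnit_zero this
    · by_contra! h
      obtain ⟨a, rfl⟩ := hρ'p a (by_contra fun ha => h.1 (hunit' a ha))
      obtain ⟨b, rfl⟩ := hρ'p b (by_contra fun hb => h.2 (hunit' b hb))
      have h1 : 1 = q p * (a * b) := by
        refine mul_left_cancel₀ hqp ?_
        linear_combination hab
      have h2 := congrArg ρ' h1
      rw [map_one, map_mul, hρ', hρp0, zero_mul] at h2
      exact one_ne_zero h2
  refine ⟨C ⧸ I, inferInstance, inferInstance,
    IsDiscreteValuationRing.ofHasUnitMulPowIrreducibleFactorization ⟨q p, hirr, fun {x} hx => ?_⟩,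
    ρ', fun α => ?_, fun c hc => ?_, ?_⟩
  · obtain ⟨x, rfl⟩ := Ideal.Quotient.mk_surjective x
    obtain ⟨n, u, hu, rfl⟩ := hfact x (fun h => hx ((hq x).mpr h))
    refine ⟨n, (hu.map q).unit, ?_⟩
    rw [IsUnit.unit_spec, ← map_pow, ← map_mul, mul_comm]
  · obtain ⟨c, rfl⟩ := hρ α
    exact ⟨q c, hρ' c⟩
  · obtain ⟨d, hd⟩ := hρ'p c hc
    exact ⟨d, by rw [hd, map_natCast]⟩
  · rwa [map_natCast] at hqp

end CohenRing

end Burch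

namespace Burch
open IsLocalRing RingTheory.Sequence

/-! ### The backward direction -/

section Backward

/-- In residue characteristic `p` the Cohen-type ring lifts. In characteristic zero a coefficient
field exists, and power series over it, with the variable sent to `0`, supply a discrete valuation
ring. -/
lemma exists_isDiscreteValuationRing_ringHom {A : Type u} [CommRing A] [IsLocalRing A]
    (hnil : IsNilpotent (maximalIdeal A)) :
    ∃ (Λ : Type u) (_ : CommRing Λ) (_ : IsDomain Λ) (_ : IsDiscreteValuationRing Λ)
      (φ : Λ →+* A), Function.Surjective ((residue A).comp φ) := by
  obtain ⟨p, hp⟩ := CharP.exists (ResidueField A)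
  rcases CharP.char_is_prime_or_zero (ResidueField A) p with hprime | rfl
  · obtain ⟨Λ, _, _, _, ρ, hρ, hρp, hp0⟩ :=
      exists_isDiscreteValuationRing_residue (ResidueField A) p hprime
    obtain ⟨φ, hφ⟩ := exists_lift_residue hnil p hprime ρ hρ hρp
      (fun c hc => (mul_eq_zero.mp hc).resolve_left hp0)
    exact ⟨Λ, inferInstance, inferInstance, inferInstance, φ, by rwa [hφ]⟩
  · have := CharP.charP_to_charZero (ResidueField A)
    obtain ⟨ψ, hψ⟩ := exists_section_residue_of_charZero hnil
    refine ⟨PowerSeries (ResidueField A), inferInstance, inferInstance, inferInstance,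
      ψ.comp PowerSeries.constantCoeff, ?_⟩
    rw [← RingHom.comp_assoc, hψ, RingHom.id_comp]
    exact PowerSeries.constantCoeff_surj

variable {R : Type u} [CommRing R] [IsLocalRing R] [IsNoetherianRing R]

/-- The image of `s` is still killed by the maximal ideal modulo the sequence and, by faithful
flatness, is still nonzero there, so no further element is regular. -/
lemma isMaximalRegular_map_completion {rs : List R} (reg : IsRegular R rs) {s : R}
    (hsJ : s ∉ Ideal.ofList rs) (hs : ∀ a ∈ maximalIdeal R, a * s ∈ Ideal.ofList rs) :
    IsMaximalRegular (rs.map (algebraMap R (AdicCompletion (maximalIdeal R) R))) := by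
  refine ⟨isRegular_map_completion reg, fun y hy => ?_⟩
  have hym : y ∈ maximalIdeal (AdicCompletion (maximalIdeal R) R) :=
    mem_maximalIdeal_of_isRegular hy y (by simp)
  have hyreg := (isWeaklyRegular_append_iff _ _ _).mp hy.1
  have h := (isWeaklyRegular_singleton_iff _ _).mp hyreg.2
  rw [isSMulRegular_quotient_iff_mem_of_smul_mem] at h
  have hys : y * algebraMap R _ s ∈ (Ideal.ofList rs).map
      (algebraMap R (AdicCompletion (maximalIdeal R) R)) := by
    rw [AdicCompletion.maximalIdeal_eq_map] at hym
    have := Ideal.mul_mem_mul hym (Ideal.mem_map_of_mem (algebraMap R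
      (AdicCompletion (maximalIdeal R) R)) (Ideal.mem_span_singleton_self s))
    rw [← Ideal.map_mul] at this
    refine Ideal.map_mono ?_ this
    rw [Ideal.mul_le]
    intro a ha b hb
    obtain ⟨c, rfl⟩ := Ideal.mem_span_singleton'.mp hb
    rw [mul_left_comm]
    exact Ideal.mul_mem_left _ _ (hs a ha)
  have hs' := h (algebraMap R _ s) (by
    rw [smul_eq_mul, smul_eq_mul, Ideal.mul_top, ← Ideal.map_ofList]
    exact hys)
  rw [smul_eq_mul, Ideal.mul_top, ← Ideal.map_ofList] at hs'
  refine hsJ ?_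
  rw [← Ideal.comap_map_eq_self_of_faithfullyFlat (A := R)
    (B := AdicCompletion (maximalIdeal R) R) (Ideal.ofList rs)]
  exact hs'

theorem isBurchRing_and_isGorenstein_of_isHypersurface (h : IsHypersurface R) :
    IsBurchRing R ∧ IsGorenstein R := by
  obtain ⟨rs, reg, ⟨s, hsJ, hs⟩, e, he⟩ := exists_isRegular_of_isHypersurface h
  have := isLocalRing_quotient (ofList_ne_top_of_isRegular reg)
  set q := Ideal.Quotient.mk (Ideal.ofList rs) with hq
  have hqs : Function.Surjective q := Ideal.Quotient.mk_surjective
  have hloc : IsLocalHom q := hqs.isLocalHom q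
  have heA : maximalIdeal (R ⧸ Ideal.ofList rs) = Ideal.span {q e} := by
    rw [← IsLocalRing.map_maximalIdeal_of_surjective q hqs, he, Ideal.map_sup, hq,
      Ideal.map_quotient_self, bot_sup_eq, Ideal.map_span, Set.image_singleton]
  have hnil : IsNilpotent (q e) := by
    refine isNilpotent_of_socle heA (s := q s)
      (fun h0 => hsJ (Ideal.Quotient.eq_zero_iff_mem.mp h0)) fun a ha => ?_
    obtain ⟨a, rfl⟩ := hqs a
    rw [← map_mul]
    exact Ideal.Quotient.eq_zero_iff_mem.mpr (hs a fun hu => ha (hu.map q))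
  obtain ⟨n, hn⟩ := hnil
  have hmn : maximalIdeal (R ⧸ Ideal.ofList rs) ^ n = ⊥ := by
    rw [heA, Ideal.span_singleton_pow, hn]
    simp
  have hinj := injective_of_maximalIdeal_eq_span heA ⟨n, hn⟩
  refine ⟨?_, isGorenstein_of_injective_quotient reg⟩
  refine ⟨rs.map (algebraMap R _), isMaximalRegular_map_completion reg hsJ hs, ?_, ?_⟩
  · rw [List.length_map, depth_eq_length_of_socle reg s hs hsJ]
  · obtain ⟨Λ, _, _, _, φ, hφ⟩ := exists_isDiscreteValuationRing_ringHom ⟨n, hmn⟩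
    obtain ⟨S, _, hS, I, hI, ⟨f⟩⟩ := exists_isBurchIdeal_of_ringHom heA ⟨n, hn⟩ φ hφ
    have hle : maximalIdeal R ^ n ≤ Ideal.ofList rs := by
      rw [← Ideal.mk_ker (I := Ideal.ofList rs), ← Ideal.map_eq_bot_iff_le_ker, Ideal.map_pow,
        IsLocalRing.map_maximalIdeal_of_surjective q hqs, hmn]
    have g := quotientCompletionEquiv (Ideal.ofList rs) n hle
    rw [Ideal.map_ofList] at g
    exact ⟨S, inferInstance, hS, I, hI, ⟨g.symm.trans f⟩⟩

end Backward

end Burch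

theorem mainTheorem8 (R : Type*) [CommRing R] [IsLocalRing R] [IsNoetherianRing R] :
    (Burch.IsBurchRing R ∧ Burch.IsGorenstein R) ↔ Burch.IsHypersurface R :=
  ⟨fun h => Burch.isHypersurface_of_isBurchRing_of_isGorenstein h.1 h.2,
    Burch.isBurchRing_and_isGorenstein_of_isHypersurface⟩
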